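/- **Conventions.** Let $\tau$ be the Archimedean tessellation of the plane $\mathbb C$ of one of the types $(4.8^2)$, $(3.6.3.6)$, $(3.12^2)$, $(4.6.12)$, $(3.4.6.4)$, $(3^2.4.3.4)$. Put $\sigma=i$ for $(4.8^2)$ and $(3^2.4.3.4)$, and $\sigma=\omega=\frac{1+i\sqrt3}{2}$ for the other four types; scale and rotate $\tau$ so that $1$ and $\sigma$ are shortest translations preserving $\tau$ (the position of the origin is arbitrary). The group of all translations preserving $\tau$ is then $T_\tau=\mathbb Z[\sigma]$. For $\alpha=a+b\sigma\in\mathbb Z[\sigma]$ with $a,b\in\mathbb Z$ write $\operatorname{Re}\alpha=a$, $\operatorname{Im}\alpha=b$ (coordinates in the basis $1,\sigma$), $\overline\alpha=a+b\overline\sigma$ and $N(\alpha)=\alpha\overline\alpha$; thus $N(1+\sigma)$ is $2$ if $\sigma=i$ and $3$ if $\sigma=\omega$. For a subgroup $G\le T_\tau$ generated by two non-collinear vectors, $\tau/G$ is a toroidal map. Its flags are the $G$-orbits of flags (incident triples vertex, edge, face) of $\tau$, and its automorphism group is the group induced on them by the normalizer of $G$ in the symmetry group of $\tau$ (the group of all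 isometries of the plane preserving $\tau$). The map $\tau/G$ is *almost regular* if it has as many flag orbits under its automorphism group as $\tau$ has under its symmetry group. The map $\tau/H$ is a *cover* of $\tau/G$ if $H\le G$, and its number of sheets is the index $[G:H]$, which is the number of flags of $\tau/H$ above each flag of $\tau/G$. A *minimal almost regular cover* of $\tau/G$ is an almost regular cover of $\tau/G$ that is minimal in the order in which $\mathcal M\le\mathcal N$ means that $\mathcal N$ is a cover of $\mathcal M$. Write $\tau_{\alpha,\beta}=\tau/\langle\alpha,\beta\rangle$ and $\tau_\eta=\tau_{\eta,\sigma\eta}$. **Theorem.** Let $\alpha,\beta\in\mathbb Z[\sigma]$ be non-collinear (linearly independent over $\mathbb R$), let $c=\gcd(\operatorname{Re}\alpha,\operatorname{Im}\alpha,\operatorname{Re}\beta,\operatorname{Im}\beta)$, and consider the condition $$(\ast)\qquad N(1+\sigma)\ \text{ divides both }\ \frac{\operatorname{Re}\alpha}{c}-\frac{\operatorname{Im}\alpha}{c}\ \text{ and }\ \frac{\operatorname{Re}\beta}{c}-\frac{\operatorname{Im}\beta}{c}.$$ Put $$\eta=\begin{cases}\dfrac{\operatorname{Im}(\overline\alpha\beta)}{N(1+\sigma)\,c}\,(1+\sigma)&\text{if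 }(\ast)\text{ holds},\\[2ex]\dfrac{\operatorname{Im}(\overline\alpha\beta)}{c}&\text{otherwise.}\end{cases}$$ Then $\eta\in\mathbb Z[\sigma]\setminus\{0\}$, and $\tau_\eta$ is the unique minimal almost regular cover of $\tau_{\alpha,\beta}$. The number of sheets of this cover, that is, the number of fundamental parallelograms of $\tau_{\alpha,\beta}$ glued together to obtain one of $\tau_\eta$, is $$K_{\min}=\begin{cases}\dfrac{|\operatorname{Im}(\overline\alpha\beta)|}{N(1+\sigma)\,c^2}&\text{if }(\ast)\text{ holds},\\[2ex]\dfrac{|\operatorname{Im}(\overline\alpha\beta)|}{c^2}&\text{otherwise.}\end{cases}$$ -/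

import Mathlib

namespace ArchMap

noncomputable section

/-! ### Plane tessellations, their symmetries and their flags

The Euclidean plane is `ℂ`. An edge is recorded by the set of its two end points, and a face (a
convex polygon) by the set of its corners. -/

/-- The cells of a tessellation of the plane. -/
structure Tessellation where
  vertices : Set ℂ
  edges : Set (Set ℂ)
  faces : Set (Set ℂ)

/-- A flag: a triple of an incident vertex, edge and face. -/
@[ext]
structure PlaneFlag (τ : Tessellation) where
  vertex : ℂ
  edge : Set ℂ
  face : Set ℂ
  vertex_mem : vertex ∈ τ.vertices
  edge_mem : edge ∈ τ.edges
  face_mem : face ∈ τ.faces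
  vertex_mem_edge : vertex ∈ edge
  edge_subset_face : edge ⊆ face

/-- The symmetry group of a tessellation: all isometries of the plane (of either orientation)
that preserve its vertices, its edges and its faces. -/
def Sym (τ : Tessellation) : Subgroup (ℂ ≃ᵢ ℂ) where
  carrier := {g | (∀ v, g v ∈ τ.vertices ↔ v ∈ τ.vertices) ∧
    (∀ e : Set ℂ, g '' e ∈ τ.edges ↔ e ∈ τ.edges) ∧
    (∀ f : Set ℂ, g '' f ∈ τ.faces ↔ f ∈ τ.faces)}
  one_mem' := by
    have h : ∀ s : Set ℂ, (1 : ℂ ≃ᵢ ℂ) '' s = s := fun s => by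
      simp [IsometryEquiv.coe_one]
    refine ⟨fun v => Iff.rfl, fun e => by rw [h], fun f => by rw [h]⟩
  mul_mem' := by
    rintro g k ⟨g1, g2, g3⟩ ⟨k1, k2, k3⟩
    have h : ∀ s : Set ℂ, (g * k) '' s = g '' (k '' s) := fun s => by
      rw [IsometryEquiv.coe_mul, Set.image_comp]
    refine ⟨fun v => (g1 (k v)).trans (k1 v), fun e => ?_, fun f => ?_⟩
    · rw [h, g2, k2]
    · rw [h, g3, k3]
  inv_mem' := by
    rintro g ⟨g1, g2, g3⟩
    have h0 : ∀ v, g (g⁻¹ v) = v := fun v => IsometryEquiv.apply_inv_self g v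
    have h : ∀ s : Set ℂ, g '' (DFunLike.coe (g⁻¹ : ℂ ≃ᵢ ℂ) '' s) = s := fun s => by
      rw [Set.image_image]; simp only [h0, Set.image_id']
    refine ⟨fun v => ?_, fun e => ?_, fun f => ?_⟩
    · rw [← g1, h0]
    · rw [← g2, h]
    · rw [← g3, h]

/-- The symmetry group acts on the flags. -/
instance (τ : Tessellation) : MulAction (Sym τ) (PlaneFlag τ) where
  smul γ Φ :=
    { vertex := γ.1 Φ.vertex
      edge := γ.1 '' Φ.edge
      face := γ.1 '' Φ.face
      vertex_mem := (γ.2.1 _).2 Φ.vertex_mem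
      edge_mem := (γ.2.2.1 _).2 Φ.edge_mem
      face_mem := (γ.2.2.2 _).2 Φ.face_mem
      vertex_mem_edge := Set.mem_image_of_mem _ Φ.vertex_mem_edge
      edge_subset_face := Set.image_mono Φ.edge_subset_face }
  one_smul Φ := by
    apply PlaneFlag.ext
    · rfl
    · exact Set.image_id Φ.edge
    · exact Set.image_id Φ.face
  mul_smul γ δ Φ := by
    apply PlaneFlag.ext
    · rfl
    · exact Set.image_comp γ.1 δ.1 Φ.edge
    · exact Set.image_comp γ.1 δ.1 Φ.face

/-- The maximal group of translations that preserve `τ`, as a group of vectors. -/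
def translations (τ : Tessellation) : AddSubgroup ℂ where
  carrier := {a | IsometryEquiv.addRight a ∈ Sym τ}
  zero_mem' := by
    have h : IsometryEquiv.addRight (0 : ℂ) = 1 := by ext z; simp
    simp only [Set.mem_ofPred_eq, h]
    exact one_mem _
  add_mem' := by
    intro a b ha hb
    have h : IsometryEquiv.addRight (a + b) =
        IsometryEquiv.addRight b * IsometryEquiv.addRight a := by
      ext z; simp [add_assoc]
    simp only [Set.mem_ofPred_eq, h]
    exact mul_mem hb ha
  neg_mem' := by
    intro a ha
    have h : IsometryEquiv.addRight (-a) = (IsometryEquiv.addRight a)⁻¹ := by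
      rw [eq_inv_iff_mul_eq_one]; ext z; simp
    simp only [Set.mem_ofPred_eq, h]
    exact inv_mem ha

/-! ### Toroidal maps -/

/-- A toroidal map `τ / G`: here `G` is a group of translations preserving `τ` that is generated
by two linearly independent (over `ℝ`) vectors. -/
@[ext]
structure ToroidalMap (τ : Tessellation) where
  lattice : AddSubgroup ℂ
  le_translations : lattice ≤ translations τ
  generated : ∃ a b : ℂ, LinearIndependent ℝ ![a, b] ∧ lattice = AddSubgroup.closure {a, b}

namespace ToroidalMap

variable {τ : Tessellation}

/-- The group `G` of `M = τ / G`, as a subgroup of the symmetry group of `τ`. -/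
def group (M : ToroidalMap τ) : Subgroup (Sym τ) where
  carrier := {γ | ∃ a ∈ M.lattice, ∀ z, γ.1 z = z + a}
  one_mem' := ⟨0, zero_mem _, fun z => by simp⟩
  mul_mem' := by
    rintro γ δ ⟨a, ha, hγ⟩ ⟨b, hb, hδ⟩
    refine ⟨b + a, add_mem hb ha, fun z => ?_⟩
    rw [Subgroup.coe_mul, IsometryEquiv.mul_apply, hδ, hγ, add_assoc]
  inv_mem' := by
    rintro γ ⟨a, ha, hγ⟩
    refine ⟨-a, neg_mem ha, fun z => ?_⟩
    apply γ.1.injective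
    rw [Subgroup.coe_inv, IsometryEquiv.apply_inv_self, hγ, neg_add_cancel_right]

/-- A flag of `τ / G` is an orbit of flags of `τ` under `G`. -/
abbrev MapFlag (M : ToroidalMap τ) : Type :=
  MulAction.orbitRel.Quotient M.group (PlaneFlag τ)

/-- The normalizer of `G` in the symmetry group of `τ` acts on the flags of `τ / G`. -/
instance (M : ToroidalMap τ) :
    MulAction (Subgroup.normalizer (M.group : Set (Sym τ))) M.MapFlag where
  smul γ := Quotient.map (fun Φ => γ.1 • Φ) (by
    rintro Φ Ψ ⟨g, rfl⟩
    refine ⟨⟨γ.1 * g.1 * γ.1⁻¹, (Subgroup.mem_normalizer_iff.1 γ.2 g.1).1 g.2⟩, ?_⟩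
    change (γ.1 * g.1 * γ.1⁻¹) • γ.1 • Ψ = γ.1 • g.1 • Ψ
    simp only [smul_smul, inv_mul_cancel_right])
  one_smul x := by
    induction x using Quotient.inductionOn with
    | h Φ => exact congrArg (Quotient.mk _) (one_smul (Sym τ) Φ)
  mul_smul γ δ x := by
    induction x using Quotient.inductionOn with
    | h Φ => exact congrArg (Quotient.mk _) (mul_smul γ.1 δ.1 Φ)

/-- The automorphism group of `τ / G`: the group of permutations of its flags that is induced by
the normalizer of `G` in the symmetry group of `τ`. -/
def Aut (M : ToroidalMap τ) : Subgroup (Equiv.Perm M.MapFlag) :=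
  (MulAction.toPermHom (Subgroup.normalizer (M.group : Set (Sym τ))) M.MapFlag).range

/-- `τ / G` is almost regular: it has as many flag orbits under its automorphism group as the
tessellation `τ` has under its symmetry group. -/
def AlmostRegular (M : ToroidalMap τ) : Prop :=
  Nat.card (MulAction.orbitRel.Quotient M.Aut M.MapFlag) =
    Nat.card (MulAction.orbitRel.Quotient (Sym τ) (PlaneFlag τ))

/-- `N = τ / H` is a cover of `M = τ / G` if `H` is a subgroup of `G`. -/
def Covers (N M : ToroidalMap τ) : Prop := N.lattice ≤ M.lattice

/-- The order on toroidal maps: `M ≤ N` if and only if `N` is a cover of `M`. -/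
instance : PartialOrder (ToroidalMap τ) where
  le M N := N.Covers M
  le_refl M := le_refl M.lattice
  le_trans _ _ _ h k := le_trans (α := AddSubgroup ℂ) k h
  le_antisymm _ _ h k := ToroidalMap.ext (le_antisymm (α := AddSubgroup ℂ) k h)

/-- The covering `τ / H → τ / G` (on flags), which sends the `H`-orbit of a flag of `τ` to its
`G`-orbit. -/
def covering {N M : ToroidalMap τ} (h : N.Covers M) : N.MapFlag → M.MapFlag :=
  Quotient.map id (by
    rintro Φ Ψ ⟨⟨γ, a, ha, hγ⟩, rfl⟩
    exact ⟨⟨γ, a, h ha, hγ⟩, rfl⟩)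

/-- `N` is a minimal almost regular cover of `M`: a minimal element, for the covering order, among
the almost regular maps that cover `M`. -/
def IsMinimalAlmostRegularCover (N M : ToroidalMap τ) : Prop :=
  Minimal (fun N' : ToroidalMap τ => N'.AlmostRegular ∧ N'.Covers M) N

/-- `N` is a `K`-sheeted cover of `M`: with `N = τ / H` and `M = τ / G`, the group `H` has index
`K` in `G` (so `K` fundamental parallelograms of `M` make up one of `N`), and every flag of `M`
lies below exactly `K` flags of `N`. -/
def IsSheetedCover (N M : ToroidalMap τ) (K : ℕ) : Prop :=
  ∃ h : N.Covers M, N.lattice.relIndex M.lattice = K ∧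
    ∀ x : M.MapFlag, Nat.card {y : N.MapFlag // covering h y = x} = K

end ToroidalMap

/-! ### The six tessellations -/

/-- The types `(4.8²)`, `(3.6.3.6)`, `(3.12²)`, `(4.6.12)`, `(3.4.6.4)`, `(3².4.3.4)`. -/
inductive ARegType
  | t4_8_8
  | t3_6_3_6
  | t3_12_12
  | t4_6_12
  | t3_4_6_4
  | t3_3_4_3_4

namespace ARegType

/-- The integer `b` with `σ² = -1 + b σ`: for `σ = i` it is `0`, and for `σ = ω = (1 + i √3) / 2`
it is `1`. -/
def b : ARegType → ℤ
  | t4_8_8 => 0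
  | t3_3_4_3_4 => 0
  | t3_6_3_6 => 1
  | t3_12_12 => 1
  | t4_6_12 => 1
  | t3_4_6_4 => 1

/-- The ring `ℤ[σ]` that goes with the type: the Gaussian integers or the Eisenstein integers. Its
elements are `re + im σ` with integers `re`, `im`. -/
abbrev Zσ (t : ARegType) : Type := QuadraticAlgebra ℤ (-1) t.b

end ARegType

/-- The complex number `ω = (1 + i √3) / 2`. -/
def omega : ℂ := (1 + Complex.I * (√3 : ℝ)) / 2

/-- The complex number `σ`. -/
def ARegType.sigma : ARegType → ℂ
  | .t4_8_8 => Complex.I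
  | .t3_3_4_3_4 => Complex.I
  | .t3_6_3_6 => omega
  | .t3_12_12 => omega
  | .t4_6_12 => omega
  | .t3_4_6_4 => omega

/-- The inclusion of `ℤ[σ]` in `ℂ`. -/
def toComplex {t : ARegType} (α : t.Zσ) : ℂ := α.re + α.im * t.sigma

/-- The element `σ` of `ℤ[σ]`. -/
def sig (t : ARegType) : t.Zσ := ⟨0, 1⟩

/-- A regular polygon, given by the number of its sides, its centre and one of its corners. -/
structure RegularPolygon where
  sides : ℕ
  centre : ℂ
  base : ℂ

namespace RegularPolygon

/-- The corners in cyclic order; corner `k` depends only on `k` modulo the number of sides. -/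
def corner (P : RegularPolygon) (k : ℤ) : ℂ :=
  P.centre + (P.base - P.centre) * Complex.exp (2 * Real.pi * Complex.I * k / P.sides)

/-- The set of all corners. -/
def corners (P : RegularPolygon) : Set ℂ := Set.range P.corner

/-- The end points of side `k`. -/
def side (P : RegularPolygon) (k : ℤ) : Set ℂ := {P.corner k, P.corner (k + 1)}

/-- The polygon translated by `a`. -/
def translate (P : RegularPolygon) (a : ℂ) : RegularPolygon :=
  ⟨P.sides, P.centre + a, P.base + a⟩

end RegularPolygon

open Complex in
/-- The faces of the six tessellations, one for each class of faces under the translations by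
`ℤ[σ]`. The side length is `√2 - 1` for `(4.8²)`, `1 / 2` for `(3.6.3.6)`, `2 - √3` for `(3.12²)`,
`(3 - √3) / 6` for `(4.6.12)`, `(√3 - 1) / 2` for `(3.4.6.4)` and `(√6 - √2) / 2` for
`(3².4.3.4)`. -/
def prototiles : ARegType → List RegularPolygon
  | .t4_8_8 =>
    let v : ℂ := 1 / 2 + (((√2 - 1) / 2 : ℝ) : ℂ) * I
    [⟨8, 0, v⟩, ⟨4, (1 + I) / 2, v⟩]
  | .t3_6_3_6 =>
    [⟨6, 0, 1 / 2⟩, ⟨3, (1 + omega) / 3, (1 + omega) / 2⟩,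
      ⟨3, 2 * (1 + omega) / 3, (1 + omega) / 2⟩]
  | .t3_12_12 =>
    let v : ℂ := 1 / 2 + (((2 - √3) / 2 : ℝ) : ℂ) * I
    [⟨12, 0, v⟩, ⟨3, (1 + omega) / 3, v⟩, ⟨3, 2 * (1 + omega) / 3, 1 + omega - v⟩]
  | .t4_6_12 =>
    let l : ℝ := (3 - √3) / 6
    let v : ℂ := (((1 - l) / 2 : ℝ) : ℂ) + ((l / 2 : ℝ) : ℂ) * I
    [⟨12, 0, v⟩, ⟨6, (1 + omega) / 3, v⟩, ⟨6, 2 * (1 + omega) / 3, 1 + omega - v⟩,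
      ⟨4, 1 / 2, v⟩, ⟨4, omega / 2, omega * v⟩, ⟨4, (1 + omega) / 2, 1 + omega ^ 2 * v⟩]
  | .t3_4_6_4 =>
    let l : ℝ := (√3 - 1) / 2
    let v : ℂ := (((1 - l) / 2 : ℝ) : ℂ) + ((l / 2 : ℝ) : ℂ) * I
    [⟨6, 0, v⟩, ⟨3, (1 + omega) / 3, v⟩, ⟨3, 2 * (1 + omega) / 3, 1 + omega - v⟩,
      ⟨4, 1 / 2, v⟩, ⟨4, omega / 2, omega * v⟩, ⟨4, (1 + omega) / 2, 1 + omega ^ 2 * v⟩]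
  | .t3_3_4_3_4 =>
    let v : ℂ := (((3 - √3) / 4 : ℝ) : ℂ) + (((√3 - 1) / 4 : ℝ) : ℂ) * I
    let d : ℂ := (((3 - √3) / 12 : ℝ) : ℂ) * (1 + I)
    [⟨4, 0, v⟩, ⟨4, (1 + I) / 2, v⟩, ⟨3, 1 / 2 + d, v⟩, ⟨3, 1 / 2 - d, v⟩,
      ⟨3, I / 2 + I * d, I * v⟩, ⟨3, I / 2 - I * d, I * v⟩]

/-- All faces of the tessellation of type `t`: the translates of the polygons above by `ℤ[σ]`. The
whole picture is moved by `o`, so that any point of it can be made the origin of the plane. -/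
def polygons (t : ARegType) (o : ℂ) : Set RegularPolygon :=
  {Q | ∃ P ∈ prototiles t, ∃ γ : t.Zσ, Q = P.translate (o + toComplex γ)}

/-- The Archimedean tessellation of type `t`, scaled and rotated so that `1` and `σ` are shortest
translations preserving it, and placed in the plane by `o`. -/
def tessellation (t : ARegType) (o : ℂ) : Tessellation where
  vertices := {z | ∃ Q ∈ polygons t o, z ∈ Q.corners}
  edges := {e | ∃ Q ∈ polygons t o, ∃ k : ℤ, e = Q.side k}
  faces := {f | ∃ Q ∈ polygons t o, f = Q.corners}

/-! ### The maps `τ_{α,β}` and `τ_η` -/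

theorem toComplex_add {t : ARegType} (α β : t.Zσ) :
    toComplex (α + β) = toComplex α + toComplex β := by
  simp [toComplex]; ring

theorem toComplex_neg {t : ARegType} (α : t.Zσ) : toComplex (-α) = -toComplex α := by
  simp [toComplex]; ring

theorem RegularPolygon.corner_translate (P : RegularPolygon) (a : ℂ) (k : ℤ) :
    (P.translate a).corner k = P.corner k + a := by
  simp only [corner, translate]; ring

theorem RegularPolygon.corners_translate (P : RegularPolygon) (a : ℂ) :
    (P.translate a).corners = (fun z => z + a) '' P.corners := by
  simp only [corners, ← Set.range_comp]
  congr 1; funext k; exact P.corner_translate a k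

theorem RegularPolygon.side_translate (P : RegularPolygon) (a : ℂ) (k : ℤ) :
    (P.translate a).side k = (fun z => z + a) '' P.side k := by
  simp only [side, Set.image_pair, corner_translate]

theorem translate_mem_polygons {t : ARegType} {o : ℂ} {Q : RegularPolygon}
    (hQ : Q ∈ polygons t o) (α : t.Zσ) : Q.translate (toComplex α) ∈ polygons t o := by
  obtain ⟨P, hP, γ, rfl⟩ := hQ
  refine ⟨P, hP, γ + α, ?_⟩
  simp only [RegularPolygon.translate, toComplex_add, add_assoc]

/-- The translations by `ℤ[σ]` preserve the tessellation. -/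
theorem toComplex_mem_translations (t : ARegType) (o : ℂ) (α : t.Zσ) :
    toComplex α ∈ translations (tessellation t o) := by
  have hv : ∀ (α : t.Zσ) (z : ℂ), z ∈ (tessellation t o).vertices →
      z + toComplex α ∈ (tessellation t o).vertices := by
    rintro α z ⟨Q, hQ, hz⟩
    exact ⟨_, translate_mem_polygons hQ α, by
      rw [RegularPolygon.corners_translate]; exact Set.mem_image_of_mem _ hz⟩
  have he : ∀ (α : t.Zσ) (e : Set ℂ), e ∈ (tessellation t o).edges →
      (fun z => z + toComplex α) '' e ∈ (tessellation t o).edges := by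
    rintro α e ⟨Q, hQ, k, rfl⟩
    exact ⟨_, translate_mem_polygons hQ α, k, (RegularPolygon.side_translate _ _ _).symm⟩
  have hf : ∀ (α : t.Zσ) (f : Set ℂ), f ∈ (tessellation t o).faces →
      (fun z => z + toComplex α) '' f ∈ (tessellation t o).faces := by
    rintro α f ⟨Q, hQ, rfl⟩
    exact ⟨_, translate_mem_polygons hQ α, (RegularPolygon.corners_translate _ _).symm⟩
  have hback : ∀ s : Set ℂ,
      (fun z => z + toComplex (-α)) '' ((fun z => z + toComplex α) '' s) = s := fun s => by
    rw [Set.image_image]; simp [toComplex_neg]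
  refine ⟨fun v => ⟨fun h => ?_, hv α v⟩, fun e => ⟨fun h => ?_, he α e⟩,
    fun f => ⟨fun h => ?_, hf α f⟩⟩
  · have := hv (-α) _ h
    rw [toComplex_neg] at this
    simpa using this
  · have := he (-α) _ h
    rwa [← hback e]
  · have := hf (-α) _ h
    rwa [← hback f]

/-- The map `τ_{α,β}`: the quotient of the tessellation of type `t` by the group of translations
generated by the non-collinear `α, β ∈ ℤ[σ]`. -/
def torus (t : ARegType) (o : ℂ) (α β : t.Zσ)
    (h : LinearIndependent ℝ ![toComplex α, toComplex β]) : ToroidalMap (tessellation t o) where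
  lattice := AddSubgroup.closure {toComplex α, toComplex β}
  le_translations := by
    rw [AddSubgroup.closure_le]
    rintro _ (rfl | rfl) <;> exact toComplex_mem_translations t o _
  generated := ⟨_, _, h, rfl⟩

/-! ### The numbers in the theorem -/

/-- The greatest common divisor `c` of the coordinates of `α` and `β`. -/
def gcdCoords {t : ARegType} (α β : t.Zσ) : ℤ :=
  (Int.gcd (Int.gcd α.re α.im) (Int.gcd β.re β.im) : ℤ)

/-- The norm `N(1 + σ)`. -/
def normOneAddSigma (t : ARegType) : ℤ := QuadraticAlgebra.norm (1 + sig t)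

/-- `N(1 + σ)` divides `Re α / c - Im α / c` and `Re β / c - Im β / c`; here `Re`, `Im` are the
coordinates with respect to `1`, `σ`, and the divisions by `c` are exact. -/
def DivCond {t : ARegType} (α β : t.Zσ) : Prop :=
  normOneAddSigma t ∣ α.re / gcdCoords α β - α.im / gcdCoords α β ∧
    normOneAddSigma t ∣ β.re / gcdCoords α β - β.im / gcdCoords α β

open Classical in
/-- The complex number `η`; here `(star α * β).im` is the `σ`-coordinate of `ᾱ β`. -/
def etaMin {t : ARegType} (α β : t.Zσ) : ℂ :=
  if DivCond α β then
    ((star α * β).im : ℂ) / (normOneAddSigma t * gcdCoords α β) * (1 + t.sigma)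
  else ((star α * β).im : ℂ) / gcdCoords α β

open Classical in
/-- The number of sheets, as a rational number. -/
def sheetsMin {t : ARegType} (α β : t.Zσ) : ℚ :=
  if DivCond α β then
    |((star α * β).im : ℚ)| / (normOneAddSigma t * (gcdCoords α β : ℚ) ^ 2)
  else |((star α * β).im : ℚ)| / (gcdCoords α β : ℚ) ^ 2

end

end ArchMap

namespace ArchMap

open scoped ComplexConjugate

/-! ### Isometries of the plane. -/

noncomputable section

/-! Almost regularity is a statement about ideals. Since `τ` has finitely many flags up to
translation and has a flag with trivial stabilizer, equality of the numbers of flag orbits forces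
every symmetry of `τ` to normalize `G`; that is, the linear parts of all symmetries preserve `G`
(`almostRegular_iff`). Every translation of `τ` lies in `ℤ[σ]` (`mem_translations_iff`), so these
linear parts have the form `x ↦ u x` or `x ↦ u x̄` with `u ∈ ℤ[σ]`; multiplication by `σ` and `x ↦ σ
x̄` occur among them. Hence `τ / G` is almost regular exactly when `G` is an ideal of `ℤ[σ]` stable
under conjugation.

The covers of `τ_{α,β}` are the sublattices of `⟨α, β⟩`, so everything reduces to finding the
largest conjugation-stable ideal inside `⟨α, β⟩` (`exists_etaMin`). Being largest, it gives a least
cover, which is the unique minimal one.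

To find it, write `α = c p`, `β = c q` with the coordinates of `p, q` coprime, and `δ = Im(p̄ q)`,
`D = c δ`. By Cramer's rule, `x, σx, x̄, σx̄ ∈ ⟨α, β⟩` means that `D` divides certain bilinear
expressions in the coordinates of `x` and of `p`, `q`. Combining them and cancelling `p, q` by a
Bézout relation shows that `x` is divisible by `D` up to a factor `N(1 + σ)`. The only possible gain
is the ramified ideal `(1 + σ)`, which is its own conjugate: `x` lies in `(D / N(1 + σ)) (1 + σ)`
when `p, q ∈ (1 + σ)`, and in `(D)` otherwise. The number of sheets is then a quotient of two
determinants. -/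

/-- Every isometry of the plane is `z ↦ u z + w` or `z ↦ u z̄ + w`. -/
theorem isometry_eq (g : ℂ ≃ᵢ ℂ) :
    ∃ u w : ℂ, (∀ z, g z = u * z + w) ∨ (∀ z, g z = u * conj z + w) := by
  set A := g.toRealAffineIsometryEquiv with hA
  have hg : ∀ z, g z = A.linearIsometryEquiv z + g 0 := fun z => by
    have := A.map_vadd 0 z
    simpa [hA, IsometryEquiv.coeFn_toRealAffineIsometryEquiv] using this
  obtain ⟨a, h | h⟩ := linear_isometry_complex A.linearIsometryEquiv
  · exact ⟨a, g 0, Or.inl fun z => by rw [hg z, h]; simp [rotation_apply]⟩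
  · exact ⟨a, g 0, Or.inr fun z => by rw [hg z, h]; simp [rotation_apply]⟩

theorem isometry_add (g : ℂ ≃ᵢ ℂ) (z a : ℂ) : g (z + a) = g z + (g a - g 0) := by
  obtain ⟨u, w, h | h⟩ := isometry_eq g
  · simp only [h]; ring
  · simp only [h, map_add, map_zero]; ring

/-! ### Symmetries of a tessellation and the criterion for almost regularity. -/

section

variable {τ : Tessellation}

/-- The translation by a vector that preserves `τ`. -/
def translationSym (a : ℂ) (ha : a ∈ translations τ) : Sym τ := ⟨IsometryEquiv.addRight a, ha⟩

@[simp]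
theorem translationSym_apply (a : ℂ) (ha : a ∈ translations τ) (z : ℂ) :
    (translationSym a ha).1 z = z + a := rfl

theorem Sym.ext {γ δ : Sym τ} (h : ∀ z, γ.1 z = δ.1 z) : γ = δ :=
  Subtype.ext (IsometryEquiv.ext h)

theorem Sym.mul_apply (γ δ : Sym τ) (z : ℂ) : (γ * δ).1 z = γ.1 (δ.1 z) := rfl

theorem Sym.apply_inv (γ : Sym τ) (z : ℂ) : γ.1 ((γ⁻¹ : Sym τ).1 z) = z :=
  IsometryEquiv.apply_inv_self γ.1 z

/-- A symmetry conjugates the translation by `a` into the translation by `γ a - γ 0`. -/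
theorem Sym.conj_apply (γ δ : Sym τ) {a : ℂ} (h : ∀ z, δ.1 z = z + a) (z : ℂ) :
    (γ * δ * γ⁻¹).1 z = z + (γ.1 a - γ.1 0) := by
  rw [Sym.mul_apply, Sym.mul_apply, h, isometry_add, Sym.apply_inv]

theorem Sym.sub_mem_translations (γ : Sym τ) {a : ℂ} (ha : a ∈ translations τ) :
    γ.1 a - γ.1 0 ∈ translations τ := by
  have h : IsometryEquiv.addRight (γ.1 a - γ.1 0) =
      (γ * translationSym a ha * γ⁻¹ : Sym τ).1 :=
    IsometryEquiv.ext fun z => (Sym.conj_apply γ _ (fun _ => rfl) z).symm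
  change IsometryEquiv.addRight (γ.1 a - γ.1 0) ∈ Sym τ
  rw [h]
  exact (γ * translationSym a ha * γ⁻¹ : Sym τ).2

namespace ToroidalMap

variable (M : ToroidalMap τ)

theorem translationSym_mem_group {a : ℂ} (ha : a ∈ M.lattice) :
    translationSym a (M.le_translations ha) ∈ M.group := ⟨a, ha, fun _ => rfl⟩

/-- Conjugating a translation by `γ` applies the linear part of `γ` to its vector. Using the
hypothesis for `γ⁻¹` as well upgrades the inclusion to the equality that a normalizer requires. -/
theorem mem_normalizer_of_forall (h : ∀ γ : Sym τ, ∀ a ∈ M.lattice, γ.1 a - γ.1 0 ∈ M.lattice)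
    (γ : Sym τ) : γ ∈ Subgroup.normalizer (M.group : Set (Sym τ)) := by
  have key : ∀ γ δ : Sym τ, δ ∈ M.group → γ * δ * γ⁻¹ ∈ M.group := by
    rintro γ δ ⟨a, ha, hδ⟩
    exact ⟨_, h γ a ha, Sym.conj_apply γ δ hδ⟩
  refine Subgroup.mem_normalizer_iff.2 fun δ => ⟨key γ δ, fun hδ => ?_⟩
  have := key γ⁻¹ _ hδ
  simpa [mul_assoc] using this

theorem sub_mem_of_mem_normalizer {γ : Sym τ}
    (hγ : γ ∈ Subgroup.normalizer (M.group : Set (Sym τ))) {a : ℂ} (ha : a ∈ M.lattice) :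
    γ.1 a - γ.1 0 ∈ M.lattice := by
  obtain ⟨b, hb, h⟩ := (Subgroup.mem_normalizer_iff.1 hγ _).1 (M.translationSym_mem_group ha)
  have h0 := (Sym.conj_apply γ (translationSym a (M.le_translations ha)) (a := a)
    (fun _ => rfl) 0).symm.trans (h 0)
  rw [add_left_cancel h0]
  exact hb

theorem translationSym_mem_normalizer {a : ℂ} (ha : a ∈ translations τ) :
    translationSym a ha ∈ Subgroup.normalizer (M.group : Set (Sym τ)) := by
  have key : ∀ δ ∈ M.group, translationSym a ha * δ = δ * translationSym a ha := by
    rintro δ ⟨b, -, hδ⟩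
    refine Sym.ext fun z => ?_
    simp only [Sym.mul_apply, hδ, translationSym_apply]
    ring
  refine Subgroup.mem_normalizer_iff.2 fun δ => ⟨fun h => ?_, fun h => ?_⟩
  · rwa [key δ h, mul_inv_cancel_right]
  · have h1 := key _ h
    rw [inv_mul_cancel_right] at h1
    rwa [← mul_left_cancel h1]

/-- The flag orbits of `τ / G` under its automorphism group map to those of `τ`. -/
def orbitMap :
    MulAction.orbitRel.Quotient M.Aut M.MapFlag →
      MulAction.orbitRel.Quotient (Sym τ) (PlaneFlag τ) :=
  Quotient.lift
    (Quotient.map id (by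
      rintro Φ Ψ ⟨g, rfl⟩
      exact ⟨g.1, rfl⟩) : M.MapFlag → MulAction.orbitRel.Quotient (Sym τ) (PlaneFlag τ))
    (by
      rintro _ x ⟨⟨_, n, rfl⟩, rfl⟩
      induction x using Quotient.inductionOn with
      | h Φ => exact Quotient.sound ⟨n.1, rfl⟩)

theorem orbitMap_surjective : Function.Surjective M.orbitMap := by
  intro y
  induction y using Quotient.inductionOn with
  | h Φ => exact ⟨Quotient.mk _ (Quotient.mk _ Φ), rfl⟩

/-- Translations commute with `G`, so they all induce automorphisms of `τ / G`; the finitely many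
representatives in `S` therefore meet every orbit. -/
theorem finite_orbits {S : Set (PlaneFlag τ)} (hS : S.Finite)
    (h : ∀ Φ : PlaneFlag τ, ∃ (a : ℂ) (ha : a ∈ translations τ), translationSym a ha • Φ ∈ S) :
    Finite (MulAction.orbitRel.Quotient M.Aut M.MapFlag) := by
  have := hS.to_subtype
  refine Finite.of_surjective
    (fun Φ : S => (Quotient.mk _ (Quotient.mk _ Φ.1) :
      MulAction.orbitRel.Quotient M.Aut M.MapFlag)) fun y => ?_
  induction y using Quotient.inductionOn with
  | h x =>
    induction x using Quotient.inductionOn with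
    | h Φ =>
      obtain ⟨a, ha, hΦ⟩ := h Φ
      refine ⟨⟨_, hΦ⟩, Quotient.sound ?_⟩
      exact ⟨⟨_, ⟨⟨_, M.translationSym_mem_normalizer ha⟩, rfl⟩⟩, rfl⟩

/-- If `τ` has finitely many flags up to translation and some flag is fixed by the identity only,
then `τ / G` is almost regular if and only if the point group of `τ` preserves `G`. -/
theorem almostRegular_iff {S : Set (PlaneFlag τ)} (hS : S.Finite)
    (h : ∀ Φ : PlaneFlag τ, ∃ (a : ℂ) (ha : a ∈ translations τ), translationSym a ha • Φ ∈ S)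
    (Φ₀ : PlaneFlag τ) (hΦ₀ : ∀ γ : Sym τ, γ • Φ₀ = Φ₀ → γ = 1) :
    M.AlmostRegular ↔ ∀ γ : Sym τ, ∀ a ∈ M.lattice, γ.1 a - γ.1 0 ∈ M.lattice := by
  constructor
  · intro hM γ a ha
    refine M.sub_mem_of_mem_normalizer ?_ ha
    -- Finiteness is essential here: `Nat.card` is `0` on infinite types, and only for a finite
    -- source does equal cardinality make the surjection injective.
    have := M.finite_orbits hS h
    have hinj := (M.orbitMap_surjective.bijective_of_nat_card_le (le_of_eq hM)).1
    have hq : M.orbitMap (Quotient.mk _ (Quotient.mk _ (γ • Φ₀))) =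
        M.orbitMap (Quotient.mk _ (Quotient.mk _ Φ₀)) := Quotient.sound ⟨γ, rfl⟩
    obtain ⟨⟨_, n, rfl⟩, hn⟩ := Quotient.exact (hinj hq)
    obtain ⟨k, hk⟩ := Quotient.exact hn
    -- The flags `γ Φ₀` and `Φ₀` of `τ / G` differ by some `n` of the normalizer, up to some `k ∈
    -- G`. The stabilizer of `Φ₀` being trivial, `k γ = n`.
    have hk' : (k.1 * γ) • Φ₀ = n.1 • Φ₀ := by rw [mul_smul]; exact hk
    have h1 : n.1⁻¹ * (k.1 * γ) = 1 := hΦ₀ _ (by rw [mul_smul, hk', inv_smul_smul])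
    have h2 : γ = k.1⁻¹ * n.1 := by
      rw [inv_mul_eq_one] at h1
      rw [h1, inv_mul_cancel_left]
    rw [h2]
    exact mul_mem (inv_mem (Subgroup.le_normalizer k.2)) n.2
  · intro hM
    refine Nat.card_congr (Equiv.ofBijective M.orbitMap ⟨fun x y => ?_, M.orbitMap_surjective⟩)
    induction x using Quotient.inductionOn with
    | h x =>
      induction y using Quotient.inductionOn with
      | h y =>
        induction x using Quotient.inductionOn with
        | h Φ =>
          induction y using Quotient.inductionOn with
          | h Ψ =>
            intro hxy
            obtain ⟨γ, rfl⟩ := Quotient.exact hxy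
            exact Quotient.sound
              ⟨⟨_, ⟨⟨γ, M.mem_normalizer_of_forall hM γ⟩, rfl⟩⟩, rfl⟩

/-! ### Sheets of a covering, and least covers. -/

/-- The flags of `N = τ / H` above a flag of `M = τ / G` correspond to `G / H`. -/
theorem card_covering_fibre {N M : ToroidalMap τ} (h : N.Covers M) (x : M.MapFlag) :
    Nat.card {y : N.MapFlag // covering h y = x} = N.lattice.relIndex M.lattice := by
  induction x using Quotient.inductionOn with
  | h Φ =>
    rw [AddSubgroup.relIndex, AddSubgroup.index]
    symm
    have hmem (a : M.lattice) : a.1 ∈ translations τ := M.le_translations a.2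
    -- A translation is determined by its effect on the vertex of a flag, so the translates of `Φ`
    -- by `a` and `b` agree modulo `H` only if `a` and `b` do.
    have key (a b : M.lattice) : (Quotient.mk _ (translationSym a.1 (hmem a) • Φ) : N.MapFlag) =
        Quotient.mk _ (translationSym b.1 (hmem b) • Φ) ↔ -a.1 + b.1 ∈ N.lattice := by
      constructor
      · intro hab
        obtain ⟨⟨k, c, hc, hk⟩, hkΦ⟩ := Quotient.exact hab
        have hv : k.1 (Φ.vertex + b.1) = Φ.vertex + a.1 := congrArg PlaneFlag.vertex hkΦ
        rw [hk] at hv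
        have : -a.1 + b.1 = -c := by linear_combination hv
        rw [this]
        exact neg_mem hc
      · intro hab
        refine Quotient.sound ⟨⟨_, N.translationSym_mem_group (neg_mem hab)⟩, ?_⟩
        change translationSym _ (N.le_translations (neg_mem hab)) • translationSym b.1 (hmem b) • Φ
          = translationSym a.1 (hmem a) • Φ
        rw [smul_smul]
        congr 1
        refine Sym.ext fun z => ?_
        simp only [Sym.mul_apply, translationSym_apply]
        ring
    refine Nat.card_congr (Equiv.ofBijective (Quotient.lift (fun a : M.lattice =>
      (⟨Quotient.mk _ (translationSym a.1 (hmem a) • Φ),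
        Quotient.sound ⟨⟨_, M.translationSym_mem_group a.2⟩, rfl⟩⟩ :
          {y : N.MapFlag // covering h y = Quotient.mk _ Φ})) ?_) ⟨?_, ?_⟩)
    · intro a b hab
      refine Subtype.ext ((key a b).2 ?_)
      exact AddSubgroup.mem_addSubgroupOf.1 (QuotientAddGroup.leftRel_apply.1 hab)
    · intro p q
      induction p using Quotient.inductionOn with
      | h a =>
        induction q using Quotient.inductionOn with
        | h b =>
          intro hab
          refine Quotient.sound (QuotientAddGroup.leftRel_apply.2 ?_)
          exact AddSubgroup.mem_addSubgroupOf.2 ((key a b).1 (congrArg Subtype.val hab))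
    · rintro ⟨y, hy⟩
      induction y using Quotient.inductionOn with
      | h Ψ =>
        obtain ⟨⟨k, a, ha, hk⟩, hkΦ⟩ := Quotient.exact hy
        refine ⟨Quotient.mk _ ⟨a, ha⟩, Subtype.ext ?_⟩
        change (Quotient.mk _ (translationSym a (hmem ⟨a, ha⟩) • Φ) : N.MapFlag) = Quotient.mk _ Ψ
        congr 1
        have : k = translationSym a (hmem ⟨a, ha⟩) := Sym.ext hk
        rw [← this]
        exact hkΦ

theorem isSheetedCover {N M : ToroidalMap τ} (h : N.Covers M) :
    N.IsSheetedCover M (N.lattice.relIndex M.lattice) :=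
  ⟨h, rfl, card_covering_fibre h⟩

/-- A least almost regular cover is the only minimal one. -/
theorem isMinimalAlmostRegularCover_iff {M L : ToroidalMap τ} (hL : L.AlmostRegular)
    (hLM : L.Covers M)
    (h : ∀ N : ToroidalMap τ, N.AlmostRegular → N.Covers M → N.lattice ≤ L.lattice)
    (N : ToroidalMap τ) : N.IsMinimalAlmostRegularCover M ↔ N = L := by
  constructor
  · intro hN
    exact le_antisymm (hN.2 ⟨hL, hLM⟩ (h N hN.1.1 hN.1.2)) (h N hN.1.1 hN.1.2)
  · rintro rfl
    exact ⟨⟨hL, hLM⟩, fun N hN _ => h N hN.1 hN.2⟩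

end ToroidalMap

end

/-! ### The ring `ℤ[σ]` inside `ℂ`. -/

section

variable {t : ARegType}

theorem ARegType.b_eq (t : ARegType) : t.b = 0 ∨ t.b = 1 := by
  cases t <;> simp [ARegType.b]

theorem omega_re : omega.re = 1 / 2 := by simp [omega]

theorem omega_im : omega.im = √3 / 2 := by simp [omega]

theorem sigma_im_ne_zero (t : ARegType) : t.sigma.im ≠ 0 := by
  cases t <;> simp [ARegType.sigma, omega_im]

theorem sigma_mul_self (t : ARegType) : t.sigma * t.sigma = -1 + t.b * t.sigma := by
  have h3 : √3 * √3 = (3 : ℝ) := Real.mul_self_sqrt (by norm_num)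
  cases t <;> simp [ARegType.sigma, ARegType.b, Complex.ext_iff, omega_re, omega_im] <;>
    constructor <;> linarith

theorem conj_sigma (t : ARegType) : conj t.sigma = t.b - t.sigma := by
  cases t <;> simp [ARegType.sigma, ARegType.b, Complex.ext_iff, omega_re, omega_im] <;> norm_num

theorem toComplex_mul (x y : t.Zσ) : toComplex (x * y) = toComplex x * toComplex y := by
  simp only [toComplex, QuadraticAlgebra.re_mul, QuadraticAlgebra.im_mul]
  push_cast
  linear_combination (-(x.im : ℂ) * y.im) * sigma_mul_self t

theorem toComplex_star (x : t.Zσ) : toComplex (star x) = conj (toComplex x) := by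
  simp only [toComplex, QuadraticAlgebra.re_star, QuadraticAlgebra.im_star, map_add, map_mul,
    conj_sigma, map_intCast]
  push_cast
  ring

theorem toComplex_sig : toComplex (sig t) = t.sigma := by simp [toComplex, sig]

theorem toComplex_one : toComplex (1 : t.Zσ) = 1 := by
  simp [toComplex, QuadraticAlgebra.re_one, QuadraticAlgebra.im_one]

theorem toComplex_injective : Function.Injective (toComplex : t.Zσ → ℂ) := by
  intro x y h
  have h2 := congrArg Complex.im h
  simp only [toComplex, Complex.add_im, Complex.mul_im, Complex.intCast_re, Complex.intCast_im,
    zero_mul, add_zero, zero_add] at h2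
  have him : x.im = y.im := by exact_mod_cast mul_right_cancel₀ (sigma_im_ne_zero t) h2
  simp only [toComplex, him, add_left_inj, Int.cast_inj] at h
  exact QuadraticAlgebra.ext h him

/-- The inclusion of `ℤ[σ]` in `ℂ`, as a homomorphism of groups. -/
noncomputable def toComplexHom (t : ARegType) : t.Zσ →+ ℂ :=
  AddMonoidHom.mk' toComplex toComplex_add

theorem star_mul_im (x y : t.Zσ) : (star x * y).im = x.re * y.im - x.im * y.re := by
  simp only [QuadraticAlgebra.im_mul, QuadraticAlgebra.re_star, QuadraticAlgebra.im_star]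
  ring

theorem linearIndependent_iff (α β : t.Zσ) :
    LinearIndependent ℝ ![toComplex α, toComplex β] ↔ (star α * β).im ≠ 0 := by
  rw [LinearIndependent.pair_iff, star_mul_im]
  constructor
  · intro h h0
    have h0' : (α.re * β.im - α.im * β.re : ℂ) = 0 := by exact_mod_cast h0
    -- If the determinant vanishes, `Im β · α - Im α · β` and `Re β · α - Re α · β` are both zero.
    -- Independence then kills both coordinates of `α`, which is absurd.
    have h1 := h β.im (-α.im) (by
      simp only [toComplex, Complex.real_smul]; push_cast; linear_combination h0')
    have h2 := h β.re (-α.re) (by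
      simp only [toComplex, Complex.real_smul]; push_cast; linear_combination (-t.sigma) * h0')
    have h3 := h 1 0 (by
      have e1 : α.im = 0 := by exact_mod_cast neg_eq_zero.1 h1.2
      have e2 : α.re = 0 := by exact_mod_cast neg_eq_zero.1 h2.2
      simp [toComplex, e1, e2])
    exact one_ne_zero h3.1
  · intro h p q hpq
    have h' : (α.re * β.im - α.im * β.re : ℝ) ≠ 0 := by exact_mod_cast h
    have h2 := congrArg Complex.im hpq
    have h1 := congrArg Complex.re hpq
    simp only [toComplex, Complex.real_smul, Complex.add_im, Complex.mul_im, Complex.intCast_re,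
      Complex.intCast_im, Complex.ofReal_re, Complex.ofReal_im, Complex.add_re, Complex.mul_re,
      Complex.zero_re, Complex.zero_im, zero_mul, add_zero, zero_add, sub_zero] at h1 h2
    have e2 : p * α.im + q * β.im = 0 := by
      refine (mul_eq_zero.1 ?_).resolve_right (sigma_im_ne_zero t)
      linear_combination h2
    have e1 : p * α.re + q * β.re = 0 := by linear_combination h1 - t.sigma.re * e2
    constructor
    · refine (mul_eq_zero.1 ?_).resolve_right h'
      linear_combination β.im * e1 - β.re * e2
    · refine (mul_eq_zero.1 ?_).resolve_right h'
      linear_combination α.re * e2 - α.im * e1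

/-! ### Sublattices of `ℤ[σ]`: membership and index. -/

theorem torus_lattice (o : ℂ) (α β : t.Zσ)
    (h : LinearIndependent ℝ ![toComplex α, toComplex β]) :
    (torus t o α β h).lattice = (AddSubgroup.closure {α, β}).map (toComplexHom t) := by
  rw [AddMonoidHom.map_closure, Set.image_pair]
  rfl

/-- Since `m η + n σ η = η (m + n σ)`, the lattice of `τ_η` is the principal ideal `(η)`. -/
theorem mem_closure_sig_mul {η x : t.Zσ} :
    x ∈ AddSubgroup.closure {η, sig t * η} ↔ ∃ z, x = η * z := by
  rw [AddSubgroup.mem_closure_pair]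
  constructor
  · rintro ⟨m, n, rfl⟩
    refine ⟨⟨m, n⟩, ?_⟩
    ext <;> simp [sig] <;> ring
  · rintro ⟨z, rfl⟩
    refine ⟨z.re, z.im, ?_⟩
    ext <;> simp [sig] <;> ring

/-- Cramer's rule: the coefficients of `x` in terms of `α, β` are the two quotients supplied by the
divisibilities. -/
theorem mem_closure_pair_of_dvd {α β x : t.Zσ} (h : (star α * β).im ≠ 0)
    (h1 : (star α * β).im ∣ (star x * β).im) (h2 : (star α * β).im ∣ (star α * x).im) :
    x ∈ AddSubgroup.closure {α, β} := by
  obtain ⟨m, hm⟩ := h1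
  obtain ⟨n, hn⟩ := h2
  rw [AddSubgroup.mem_closure_pair]
  refine ⟨m, n, ?_⟩
  simp only [star_mul_im] at h hm hn
  ext
  · refine mul_left_cancel₀ h ?_
    simp only [QuadraticAlgebra.re_add, QuadraticAlgebra.re_smul, smul_eq_mul]
    linear_combination (-α.re) * hm - β.re * hn
  · refine mul_left_cancel₀ h ?_
    simp only [QuadraticAlgebra.im_add, QuadraticAlgebra.im_smul, smul_eq_mul]
    linear_combination (-α.im) * hm - β.im * hn

theorem dvd_of_mem_closure_pair {α β x : t.Zσ} (h : x ∈ AddSubgroup.closure {α, β}) :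
    (star α * β).im ∣ (star x * β).im ∧ (star α * β).im ∣ (star α * x).im := by
  rw [AddSubgroup.mem_closure_pair] at h
  obtain ⟨m, n, rfl⟩ := h
  simp only [star_mul_im]
  refine ⟨⟨m, ?_⟩, ⟨n, ?_⟩⟩ <;> simp <;> ring

/-- The index is the absolute value of the determinant of `α, β` in the basis `1, σ`, and this
determinant is `Im(ᾱ β)`. -/
theorem index_closure_pair {α β : t.Zσ} (h : (star α * β).im ≠ 0) :
    (AddSubgroup.closure {α, β}).index = (star α * β).im.natAbs := by
  have hli : LinearIndependent ℤ ![α, β] := by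
    rw [LinearIndependent.pair_iff]
    intro p q hpq
    rw [star_mul_im] at h
    have e1 := congrArg QuadraticAlgebra.re hpq
    have e2 := congrArg QuadraticAlgebra.im hpq
    simp at e1 e2
    constructor
    · refine (mul_eq_zero.1 ?_).resolve_right h
      linear_combination β.im * e1 - β.re * e2
    · refine (mul_eq_zero.1 ?_).resolve_right h
      linear_combination α.re * e2 - α.im * e1
  have hcl : AddSubgroup.closure {α, β} =
      (Submodule.span ℤ (Set.range ![α, β])).toAddSubgroup := by
    rw [Submodule.span_int_eq_addSubgroupClosure]
    simp [Set.pair_comm]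
  have := Submodule.natAbs_det_basis_change (QuadraticAlgebra.basis (-1 : ℤ) t.b) _
    (Module.Basis.span hli)
  rw [hcl]
  refine this.symm.trans ?_
  congr 1
  rw [Module.Basis.det_apply, Matrix.det_fin_two, star_mul_im]
  simp [Module.Basis.toMatrix_apply, Module.Basis.span_apply]
  ring

/-! ### Common divisors of the coordinates and the ideal `(1 + σ)`. -/

theorem normOneAddSigma_eq (t : ARegType) : normOneAddSigma t = 2 + t.b := by
  simp [normOneAddSigma, QuadraticAlgebra.norm_def, sig, QuadraticAlgebra.re_one,
    QuadraticAlgebra.im_one]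
  ring

theorem normOneAddSigma_pos (t : ARegType) : 0 < normOneAddSigma t := by
  rw [normOneAddSigma_eq]
  rcases t.b_eq with h | h <;> rw [h] <;> norm_num

theorem gcdCoords_dvd (α β : t.Zσ) : gcdCoords α β ∣ α.re ∧ gcdCoords α β ∣ α.im ∧
    gcdCoords α β ∣ β.re ∧ gcdCoords α β ∣ β.im :=
  ⟨(Int.gcd_dvd_left _ _).trans (Int.gcd_dvd_left _ _),
    (Int.gcd_dvd_left _ _).trans (Int.gcd_dvd_right _ _),
    (Int.gcd_dvd_right _ _).trans (Int.gcd_dvd_left _ _),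
    (Int.gcd_dvd_right _ _).trans (Int.gcd_dvd_right _ _)⟩

/-- Division of `α` and `β` by the greatest common divisor of their coordinates. -/
theorem exists_primitive {α β : t.Zσ} (h : gcdCoords α β ≠ 0) :
    ∃ p q : t.Zσ, α = gcdCoords α β • p ∧ β = gcdCoords α β • q ∧
      (∃ u v u' v' : ℤ, p.re * u + p.im * v + (q.re * u' + q.im * v') = 1) ∧
      (DivCond α β ↔ normOneAddSigma t ∣ p.re - p.im ∧ normOneAddSigma t ∣ q.re - q.im) := by
  obtain ⟨⟨a, ha⟩, ⟨b, hb⟩, ⟨c, hc⟩, ⟨d, hd⟩⟩ := gcdCoords_dvd α β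
  refine ⟨⟨a, b⟩, ⟨c, d⟩, ?_, ?_, ?_, ?_⟩
  · ext
    · simpa using ha
    · simpa using hb
  · ext
    · simpa using hc
    · simpa using hd
  · have e1 := Int.gcd_eq_gcd_ab (Int.gcd α.re α.im) (Int.gcd β.re β.im)
    have e2 := Int.gcd_eq_gcd_ab α.re α.im
    have e3 := Int.gcd_eq_gcd_ab β.re β.im
    change gcdCoords α β = _ at e1
    rw [e2, e3] at e1
    -- The rewriting has also changed the arguments of the outer Bézout coefficients; only their
    -- being integers matters.
    generalize Int.gcdA _ (_ + _) = m at e1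
    generalize Int.gcdB _ (_ + _) = n at e1
    refine ⟨Int.gcdA α.re α.im * m, Int.gcdB α.re α.im * m, Int.gcdA β.re β.im * n,
      Int.gcdB β.re β.im * n, mul_left_cancel₀ h ?_⟩
    rw [mul_one]
    conv_rhs => rw [e1]
    linear_combination (-(Int.gcdA α.re α.im * m)) * ha - Int.gcdB α.re α.im * m * hb -
      Int.gcdA β.re β.im * n * hc - Int.gcdB β.re β.im * n * hd
  · have e1 : α.re / gcdCoords α β = a := Int.ediv_eq_of_eq_mul_right h ha
    have e2 : α.im / gcdCoords α β = b := Int.ediv_eq_of_eq_mul_right h hb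
    have e3 : β.re / gcdCoords α β = c := Int.ediv_eq_of_eq_mul_right h hc
    have e4 : β.im / gcdCoords α β = d := Int.ediv_eq_of_eq_mul_right h hd
    rw [DivCond, e1, e2, e3, e4]

/-- The elements of the ideal generated by `1 + σ`. -/
theorem exists_one_add_sig_mul {y : t.Zσ} (h : normOneAddSigma t ∣ y.re - y.im) :
    ∃ z, y = (1 + sig t) * z := by
  rw [normOneAddSigma_eq] at h
  obtain ⟨k, hk⟩ := h
  -- From `(1 + σ)(r + s σ) = (r - s) + (r + (1 + b) s) σ`, where `k = (Re y - Im y) / (2 + b)`.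
  refine ⟨⟨y.re - k, -k⟩, ?_⟩
  rcases t.b_eq with hb | hb <;> simp only [hb] at hk <;> ext <;>
    simp [sig, hb, QuadraticAlgebra.re_one, QuadraticAlgebra.im_one] <;> linarith

/-! ### Divisibility conditions for membership in the largest stable ideal. -/

theorem dvd_of_primitive {p q : t.Zσ}
    (h : ∃ u v u' v' : ℤ, p.re * u + p.im * v + (q.re * u' + q.im * v') = 1) {D k : ℤ}
    (hp : D ∣ k * p.re) (hp' : D ∣ k * p.im) (hq : D ∣ k * q.re) (hq' : D ∣ k * q.im) :
    D ∣ k := by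
  obtain ⟨u, v, u', v', h⟩ := h
  have : k = k * p.re * u + k * p.im * v + (k * q.re * u' + k * q.im * v') := by
    linear_combination (-k) * h
  rw [this]
  exact dvd_add (dvd_add (hp.mul_right _) (hp'.mul_right _))
    (dvd_add (hq.mul_right _) (hq'.mul_right _))

/-- `D` divides the `σ`-coordinates of `x̄ r`, `x r` and their multiples by `σ`. -/
def DvdProducts (D : ℤ) (x r : t.Zσ) : Prop :=
  D ∣ x.re * r.im - x.im * r.re ∧ D ∣ x.im * r.im + (x.re + t.b * x.im) * r.re ∧
    D ∣ (x.re + t.b * x.im) * r.im + x.im * r.re ∧ D ∣ x.im * r.im - x.re * r.re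

/-- The factor `2 Re x + b Im x` is the trace `x + x̄`; adding the conditions for `x` and `x̄` with
suitable signs isolates it. -/
theorem DvdProducts.trace_re {D : ℤ} {x r : t.Zσ} (h : DvdProducts D x r) :
    D ∣ (2 * x.re + t.b * x.im) * r.re := by
  exact (dvd_sub h.2.1 h.2.2.2).trans (dvd_of_eq (by ring))

theorem DvdProducts.trace_im {D : ℤ} {x r : t.Zσ} (h : DvdProducts D x r) :
    D ∣ (2 * x.re + t.b * x.im) * r.im := by
  exact (dvd_add h.1 h.2.2.1).trans (dvd_of_eq (by ring))

/-- The Gaussian case. The conditions combine to `D ∣ 2x`, say `2x = D (y + z i)`, and then say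
modulo `2` that `y r.im ≡ z r.re` and `z r.im ≡ y r.re` for `r = p, q`. If some `r` has coordinates
of different parity, `y` and `z` are even, so `D ∣ x`. Otherwise some `r` has both coordinates odd,
because the gcd is `1`, and only `y ≡ z` follows: the factor `1 + i`. -/
theorem exists_mul_of_b_eq_zero (hb : t.b = 0) {p q x : t.Zσ} {D : ℤ} (hD : D ≠ 0)
    (hpq : ∃ u v u' v' : ℤ, p.re * u + p.im * v + (q.re * u' + q.im * v') = 1)
    (hp : DvdProducts D x p) (hq : DvdProducts D x q) :
    (¬ (2 ∣ p.re - p.im ∧ 2 ∣ q.re - q.im) → D ∣ x.re ∧ D ∣ x.im) ∧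
    ∀ E, D = 2 * E → (2 ∣ p.re - p.im ∧ 2 ∣ q.re - q.im) →
      ∃ y : t.Zσ, x = E • y ∧ 2 ∣ y.re - y.im := by
  have h1 : D ∣ 2 * x.re := by
    have := dvd_of_primitive hpq hp.trace_re hp.trace_im hq.trace_re hq.trace_im
    simpa [hb] using this
  have key (r : t.Zσ) (hr : DvdProducts D x r) : D ∣ 2 * x.im * r.re ∧ D ∣ 2 * x.im * r.im := by
    obtain ⟨a, b, c, d⟩ := hr
    simp only [hb, zero_mul, add_zero] at b c
    constructor
    · exact (dvd_sub c a).trans (dvd_of_eq (by ring))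
    · exact (dvd_add b d).trans (dvd_of_eq (by ring))
  have h2 : D ∣ 2 * x.im :=
    dvd_of_primitive hpq (key p hp).1 (key p hp).2 (key q hq).1 (key q hq).2
  obtain ⟨y, hy⟩ := h1
  obtain ⟨z, hz⟩ := h2
  have key2 (r : t.Zσ) (hr : DvdProducts D x r) :
      2 ∣ y * r.im - z * r.re ∧ 2 ∣ z * r.im - y * r.re := by
    obtain ⟨⟨m, hm⟩, -, -, ⟨n, hn⟩⟩ := hr
    refine ⟨⟨m, mul_left_cancel₀ hD ?_⟩, ⟨n, mul_left_cancel₀ hD ?_⟩⟩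
    · linear_combination 2 * hm - r.im * hy + r.re * hz
    · linear_combination 2 * hn - r.im * hz + r.re * hy
  constructor
  · intro hn
    have key3 (r : t.Zσ) (hr : DvdProducts D x r) (h : ¬ 2 ∣ r.re - r.im) :
        2 ∣ y ∧ 2 ∣ z := by
      obtain ⟨a, b⟩ := key2 r hr
      simp only [← even_iff_two_dvd, Int.even_sub, Int.even_mul] at a b h ⊢
      tauto
    have h2 : 2 ∣ y ∧ 2 ∣ z := by
      by_cases h : 2 ∣ p.re - p.im
      · exact key3 q hq fun h' => hn ⟨h, h'⟩
      · exact key3 p hp h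
    obtain ⟨⟨k, rfl⟩, ⟨l, rfl⟩⟩ := h2
    exact ⟨⟨k, by linarith⟩, ⟨l, by linarith⟩⟩
  · rintro E rfl ⟨hp2, hq2⟩
    refine ⟨⟨y, z⟩, ?_, ?_⟩
    · ext
      · simp; linarith
      · simp; linarith
    · obtain ⟨u, v, u', v', hu⟩ := hpq
      have a := (key2 p hp).1
      have b := (key2 q hq).1
      have hodd : ¬ Even (p.re * u + p.im * v + (q.re * u' + q.im * v')) := by
        rw [hu]; exact Int.not_even_one
      simp only [← even_iff_two_dvd, Int.even_sub, Int.even_add, Int.even_mul] at a b hp2 hq2 hodd ⊢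
      by_cases h1 : Even y <;> by_cases h2 : Even z <;>
        simp_all [-Int.not_even_iff_odd]

/-- The Eisenstein case. Here `D` divides `2 Re x + Im x` and `Re x - Im x`, hence `3 Im x`. With `3
Im x = D j`, the last condition modulo `3` gives `3 ∣ j (r.re - r.im)`, so either `3 ∣ j` and `D ∣
x`, or both `p` and `q` lie in `(1 + ω)`. The second conclusion already follows from `D ∣ Re x - Im
x`. -/
theorem exists_mul_of_b_eq_one (hb : t.b = 1) {p q x : t.Zσ} {D : ℤ} (hD : D ≠ 0)
    (hpq : ∃ u v u' v' : ℤ, p.re * u + p.im * v + (q.re * u' + q.im * v') = 1)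
    (hp : DvdProducts D x p) (hq : DvdProducts D x q) :
    (¬ (3 ∣ p.re - p.im ∧ 3 ∣ q.re - q.im) → D ∣ x.re ∧ D ∣ x.im) ∧
    ∀ E, D = 3 * E → ∃ y : t.Zσ, x = E • y ∧ 3 ∣ y.re - y.im := by
  have h1 : D ∣ 2 * x.re + x.im := by
    have := dvd_of_primitive hpq hp.trace_re hp.trace_im hq.trace_re hq.trace_im
    simpa [hb] using this
  have key (r : t.Zσ) (hr : DvdProducts D x r) :
      D ∣ (x.re - x.im) * r.re ∧ D ∣ (x.re - x.im) * r.im := by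
    obtain ⟨a, b, c, d⟩ := hr
    simp only [hb, one_mul] at b c
    constructor
    · exact (dvd_sub (dvd_add a b) c).trans (dvd_of_eq (by ring))
    · exact (dvd_sub (dvd_sub c b) d).trans (dvd_of_eq (by ring))
  have h2 : D ∣ x.re - x.im :=
    dvd_of_primitive hpq (key p hp).1 (key p hp).2 (key q hq).1 (key q hq).2
  have h3 : D ∣ 3 * x.im := by
    exact (dvd_sub h1 (h2.mul_left 2)).trans (dvd_of_eq (by ring))
  obtain ⟨k, hk⟩ := h2
  obtain ⟨j, hj⟩ := h3
  constructor
  · intro hn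
    have key3 (r : t.Zσ) (hr : DvdProducts D x r) (h : ¬ 3 ∣ r.re - r.im) : 3 ∣ j := by
      obtain ⟨-, -, -, ⟨m, hm⟩⟩ := hr
      have : 3 ∣ j * (r.re - r.im) := by
        refine ⟨-m - k * r.re, mul_left_cancel₀ hD ?_⟩
        linear_combination (-3) * hm - (r.re - r.im) * hj - 3 * r.re * hk
      exact (Int.prime_three.dvd_mul.1 this).resolve_right h
    have h3 : 3 ∣ j := by
      by_cases h : 3 ∣ p.re - p.im
      · exact key3 q hq fun h' => hn ⟨h, h'⟩
      · exact key3 p hp h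
    obtain ⟨l, rfl⟩ := h3
    have : x.im = D * l := by linarith
    exact ⟨⟨k + l, by linarith⟩, ⟨l, this⟩⟩
  · rintro E rfl
    refine ⟨⟨j + 3 * k, j⟩, ?_, ⟨k, by ring⟩⟩
    ext
    · simp; linarith
    · simp; linarith

/-- Cramer's rule is applied to `x, σx, x̄, σx̄`. The determinant of `c p, c q` is `c² δ`, and each
numerator carries one factor `c`, so the modulus is `c δ`. -/
theorem dvdProducts_of_forall {p q x : t.Zσ} {c : ℤ} (hc : c ≠ 0)
    (h : ∀ z, z * x ∈ AddSubgroup.closure {c • p, c • q} ∧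
      z * star x ∈ AddSubgroup.closure {c • p, c • q}) :
    DvdProducts (c * (star p * q).im) x p ∧ DvdProducts (c * (star p * q).im) x q := by
  have key (y : t.Zσ) (hy : y ∈ AddSubgroup.closure {c • p, c • q}) :
      c * (star p * q).im ∣ y.re * q.im - y.im * q.re ∧
        c * (star p * q).im ∣ y.re * p.im - y.im * p.re := by
    obtain ⟨⟨k, hk⟩, ⟨l, hl⟩⟩ := dvd_of_mem_closure_pair hy
    simp only [star_mul_im, QuadraticAlgebra.re_smul, QuadraticAlgebra.im_smul, smul_eq_mul] at *
    refine ⟨⟨k, mul_left_cancel₀ hc ?_⟩, ⟨-l, mul_left_cancel₀ hc ?_⟩⟩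
    · linear_combination hk
    · linear_combination -hl
  have a := key _ (h 1).1
  have b := key _ (h (sig t)).1
  have c := key _ (h 1).2
  have d := key _ (h (sig t)).2
  simp only [sig, one_mul, QuadraticAlgebra.re_mul, QuadraticAlgebra.im_mul,
    QuadraticAlgebra.re_star, QuadraticAlgebra.im_star, zero_mul, zero_add] at a b c d
  refine ⟨⟨a.2, (dvd_neg.2 b.2).trans (dvd_of_eq (by ring)), c.2.trans (dvd_of_eq (by ring)),
    d.2.trans (dvd_of_eq (by ring))⟩, ⟨a.1, (dvd_neg.2 b.1).trans (dvd_of_eq (by ring)),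
    c.1.trans (dvd_of_eq (by ring)), d.1.trans (dvd_of_eq (by ring))⟩⟩

/-- The coordinates `1 + b` and `-1` of the conjugate of `1 + σ` differ by `2 + b = N(1 + σ)`. So
the ideal `(1 + σ)` is conjugation-stable. -/
theorem exists_star_one_add_sig (t : ARegType) : ∃ w, star (1 + sig t) = (1 + sig t) * w := by
  refine exists_one_add_sig_mul ?_
  rw [normOneAddSigma_eq]
  rcases t.b_eq with hb | hb <;>
    simp [sig, hb, QuadraticAlgebra.re_one, QuadraticAlgebra.im_one]

theorem gcdCoords_ne_zero {α β : t.Zσ} (h : (star α * β).im ≠ 0) : gcdCoords α β ≠ 0 := by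
  intro h0
  obtain ⟨h1, h2, -, -⟩ := gcdCoords_dvd α β
  rw [h0, zero_dvd_iff] at h1 h2
  exact h (by rw [star_mul_im, h1, h2]; ring)

/-- Together with `index_closure_pair`, this makes `|N(η)|` the index of `(η)` in `ℤ[σ]`. -/
theorem star_mul_sig_mul_im (η : t.Zσ) : (star η * (sig t * η)).im = QuadraticAlgebra.norm η := by
  simp [sig, QuadraticAlgebra.norm_def]
  ring

theorem norm_sig_add_one_mul (E : ℤ) : QuadraticAlgebra.norm (E • (1 + sig t)) =
    E ^ 2 * normOneAddSigma t := by
  rw [normOneAddSigma_eq]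
  simp [QuadraticAlgebra.norm_def, sig]
  ring

/-- `η ℤ[σ]` is the largest subgroup of `⟨α, β⟩` that is stable under `σ` and conjugation. -/
theorem exists_etaMin {α β : t.Zσ} (h : (star α * β).im ≠ 0) :
    ∃ η : t.Zσ, toComplex η = etaMin α β ∧ QuadraticAlgebra.norm η ≠ 0 ∧
      (∃ w, star η = η * w) ∧ (∀ z, η * z ∈ AddSubgroup.closure {α, β}) ∧
      (∀ x, (∀ z, z * x ∈ AddSubgroup.closure {α, β} ∧
        z * star x ∈ AddSubgroup.closure {α, β}) → ∃ z, x = η * z) ∧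
      (|(QuadraticAlgebra.norm η : ℤ)| : ℚ) = sheetsMin α β * |((star α * β).im : ℚ)| := by
  have hc := gcdCoords_ne_zero h
  obtain ⟨p, q, hα, hβ, hpq, hdiv⟩ := exists_primitive hc
  have hnpos := normOneAddSigma_pos t
  have hn := normOneAddSigma_eq t
  have hideal (y : t.Zσ) := exists_one_add_sig_mul (y := y)
  have hnorm := norm_sig_add_one_mul (t := t)
  unfold etaMin sheetsMin
  simp only [hdiv]
  generalize gcdCoords α β = c at *
  generalize normOneAddSigma t = n at *
  subst hα hβ
  set δ := (star p * q).im with hδ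
  have hΔ : (star (c • p) * (c • q)).im = c ^ 2 * δ := by
    simp only [hδ, star_mul_im, QuadraticAlgebra.re_smul, QuadraticAlgebra.im_smul, smul_eq_mul]
    ring
  have hδ0 : δ ≠ 0 := fun h0 => h (by rw [hΔ, h0, mul_zero])
  have hD : c * δ ≠ 0 := mul_ne_zero hc hδ0
  have hcC : (c : ℂ) ≠ 0 := by exact_mod_cast hc
  have hnC : (n : ℂ) ≠ 0 := by exact_mod_cast hnpos.ne'
  have hcQ : (c : ℚ) ≠ 0 := by exact_mod_cast hc
  have hnQ : (0 : ℚ) < n := by exact_mod_cast hnpos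
  have hmem (y : t.Zσ) (h1 : c * δ ∣ y.re * q.im - y.im * q.re)
      (h2 : c * δ ∣ p.re * y.im - p.im * y.re) : y ∈ AddSubgroup.closure {c • p, c • q} := by
    refine mem_closure_pair_of_dvd h ?_ ?_ <;> rw [hΔ, sq, mul_assoc]
    · refine (mul_dvd_mul_left c h1).trans (dvd_of_eq ?_)
      simp only [star_mul_im, QuadraticAlgebra.re_smul, QuadraticAlgebra.im_smul, smul_eq_mul]
      ring
    · refine (mul_dvd_mul_left c h2).trans (dvd_of_eq ?_)
      simp only [star_mul_im, QuadraticAlgebra.re_smul, QuadraticAlgebra.im_smul, smul_eq_mul]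
      ring
  by_cases hdc : n ∣ p.re - p.im ∧ n ∣ q.re - q.im
  · simp only [if_pos hdc]
    obtain ⟨⟨k, hk⟩, ⟨l, hl⟩⟩ := hdc
    -- Both `p` and `q` have congruent coordinates modulo `n`, so their determinant vanishes modulo
    -- `n`. With `δ = n e` the generator is `c e (1 + σ)`.
    obtain ⟨e, he⟩ : n ∣ δ := ⟨k * q.im - l * p.im, by
      rw [hδ, star_mul_im]; linear_combination q.im * hk - p.im * hl⟩
    have he0 : e ≠ 0 := by rintro rfl; exact hδ0 (by rw [he, mul_zero])
    refine ⟨(c * e) • (1 + sig t), ?_, ?_, ?_, ?_, ?_, ?_⟩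
    · rw [hΔ, he]
      simp only [toComplex, sig, QuadraticAlgebra.re_smul, QuadraticAlgebra.im_smul,
        QuadraticAlgebra.re_add, QuadraticAlgebra.im_add, QuadraticAlgebra.re_one,
        QuadraticAlgebra.im_one, smul_eq_mul]
      push_cast
      field_simp
    · rw [hnorm]
      exact mul_ne_zero (pow_ne_zero _ (mul_ne_zero hc he0)) hnpos.ne'
    · obtain ⟨w, hw⟩ := exists_star_one_add_sig t
      exact ⟨w, by rw [smul_mul_assoc, ← hw, star_zsmul]⟩
    · intro z
      have hb : t.b = n - 2 := by linarith
      have hq : q.re = n * l + q.im := by linarith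
      have hp : p.re = n * k + p.im := by linarith
      refine hmem _ ⟨l * z.im - l * z.re - q.im * z.im - n * l * z.im, ?_⟩
        ⟨k * z.re - k * z.im + p.im * z.im + n * k * z.im, ?_⟩
      · rw [he]
        simp [sig, hb, hq]
        ring
      · rw [he]
        simp [sig, hb, hp]
        ring
    · intro x hx
      obtain ⟨hxp, hxq⟩ := dvdProducts_of_forall hc hx
      rw [← hδ] at hxp hxq
      have : ∃ y : t.Zσ, x = (c * e) • y ∧ n ∣ y.re - y.im := by
        rcases t.b_eq with hb | hb <;> rw [hb] at hn <;> norm_num at hn <;> subst hn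
        · exact (exists_mul_of_b_eq_zero hb hD hpq hxp hxq).2 (c * e) (by rw [he]; ring)
            ⟨⟨k, hk⟩, ⟨l, hl⟩⟩
        · exact (exists_mul_of_b_eq_one hb hD hpq hxp hxq).2 (c * e) (by rw [he]; ring)
      obtain ⟨y, rfl, hy⟩ := this
      obtain ⟨z, rfl⟩ := hideal y hy
      exact ⟨z, (smul_mul_assoc _ _ _).symm⟩
    · rw [hnorm, hΔ, he]
      push_cast
      simp only [abs_mul, abs_pow, abs_of_pos hnQ, sq_abs, mul_pow]
      field_simp
      rw [sq_abs]
  · simp only [if_neg hdc]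
    have hnorm : QuadraticAlgebra.norm (⟨c * δ, 0⟩ : t.Zσ) = (c * δ) ^ 2 := by
      simp [QuadraticAlgebra.norm_def, sq]
    -- The generator is the rational integer `D = c δ`, which equals its conjugate.
    refine ⟨⟨c * δ, 0⟩, ?_, ?_, ⟨1, ?_⟩, ?_, ?_, ?_⟩
    · rw [hΔ]
      simp only [toComplex]
      push_cast
      field_simp
      ring
    · rw [hnorm]
      exact pow_ne_zero _ hD
    · rw [mul_one]
      ext <;> simp
    · intro z
      refine hmem _ ⟨z.re * q.im - z.im * q.re, ?_⟩ ⟨p.re * z.im - p.im * z.re, ?_⟩ <;>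
      · simp
        ring
    · intro x hx
      obtain ⟨hxp, hxq⟩ := dvdProducts_of_forall hc hx
      rw [← hδ] at hxp hxq
      have : c * δ ∣ x.re ∧ c * δ ∣ x.im := by
        rcases t.b_eq with hb | hb <;> rw [hb] at hn <;> norm_num at hn <;> subst hn
        · exact (exists_mul_of_b_eq_zero hb hD hpq hxp hxq).1 hdc
        · exact (exists_mul_of_b_eq_one hb hD hpq hxp hxq).1 hdc
      obtain ⟨⟨k, hk⟩, ⟨l, hl⟩⟩ := this
      refine ⟨⟨k, l⟩, ?_⟩
      ext
      · simp [hk]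
      · simp [hl]
    · rw [hnorm, hΔ]
      push_cast
      simp only [abs_mul, abs_pow, sq_abs, mul_pow]
      field_simp
      rw [sq_abs]

end

/-! ### Regular polygons and roots of unity. -/

/-- The primitive `n`-th root of unity `exp (2 π i / n)`. -/
def zeta (n : ℕ) : ℂ := Complex.exp (2 * Real.pi * Complex.I / n)

theorem zeta_ne_zero (n : ℕ) : zeta n ≠ 0 := Complex.exp_ne_zero _

theorem zeta_isPrimitiveRoot {n : ℕ} (hn : n ≠ 0) : IsPrimitiveRoot (zeta n) n :=
  Complex.isPrimitiveRoot_exp n hn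

theorem conj_zeta (n : ℕ) : conj (zeta n) = (zeta n)⁻¹ := by
  rw [zeta, ← Complex.exp_conj, ← Complex.exp_neg]
  congr 1
  simp only [map_div₀, map_mul, Complex.conj_I, Complex.conj_ofReal, map_natCast, map_ofNat]
  ring

theorem zeta_eq (n : ℕ) : zeta n =
    (Real.cos (2 * Real.pi / n) : ℂ) + (Real.sin (2 * Real.pi / n) : ℂ) * Complex.I := by
  rw [zeta, Complex.ofReal_cos, Complex.ofReal_sin, ← Complex.exp_mul_I]
  congr 1
  push_cast
  ring

theorem zeta_four : zeta 4 = Complex.I := by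
  rw [zeta_eq, show 2 * Real.pi / (4 : ℕ) = Real.pi / 2 by push_cast; ring]
  simp

theorem zeta_six : zeta 6 = omega := by
  rw [zeta_eq, show 2 * Real.pi / (6 : ℕ) = Real.pi / 3 by push_cast; ring, Real.cos_pi_div_three,
    Real.sin_pi_div_three]
  apply Complex.ext <;> simp [omega_re, omega_im]

theorem zeta_three : zeta 3 = omega - 1 := by
  rw [zeta_eq, show 2 * Real.pi / (3 : ℕ) = Real.pi - Real.pi / 3 by push_cast; ring,
    Real.cos_pi_sub, Real.sin_pi_sub, Real.cos_pi_div_three, Real.sin_pi_div_three]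
  apply Complex.ext <;> simp [omega_re, omega_im]
  norm_num

theorem zeta_eight : zeta 8 = ((√2 / 2 : ℝ) : ℂ) + ((√2 / 2 : ℝ) : ℂ) * Complex.I := by
  rw [zeta_eq, show 2 * Real.pi / (8 : ℕ) = Real.pi / 4 by push_cast; ring, Real.cos_pi_div_four,
    Real.sin_pi_div_four]

theorem zeta_twelve : zeta 12 = ((√3 / 2 : ℝ) : ℂ) + ((1 / 2 : ℝ) : ℂ) * Complex.I := by
  rw [zeta_eq, show 2 * Real.pi / (12 : ℕ) = Real.pi / 6 by push_cast; ring, Real.cos_pi_div_six,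
    Real.sin_pi_div_six]

namespace RegularPolygon

theorem corner_eq (P : RegularPolygon) (k : ℤ) :
    P.corner k = P.centre + (P.base - P.centre) * zeta P.sides ^ k := by
  rw [corner, zeta, ← Complex.exp_int_mul]
  congr 3
  ring

theorem corner_natCast (P : RegularPolygon) (k : ℕ) :
    P.corner k = P.centre + (P.base - P.centre) * zeta P.sides ^ k := by
  rw [corner_eq, zpow_natCast]

theorem corner_zero (P : RegularPolygon) : P.corner 0 = P.base := by
  rw [corner_eq]; simp

theorem corner_of_rotation {P Q : RegularPolygon} {u w : ℂ} {j : ℤ} (hs : P.sides = Q.sides)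
    (hc : u * P.centre + w = Q.centre) (hb : u * P.base + w = Q.corner j) (k : ℤ) :
    u * P.corner k + w = Q.corner (j + k) := by
  rw [corner_eq] at *
  rw [corner_eq, zpow_add₀ (zeta_ne_zero _), ← hs] at *
  linear_combination hc * (1 - zeta P.sides ^ k) + hb * zeta P.sides ^ k

/-- As `conj ζ = ζ⁻¹`, a reflection reverses the cyclic order; this is the reason for `j - k`.
Matching the centre and one corner determines all corners. -/
theorem corner_of_reflection {P Q : RegularPolygon} {u w : ℂ} {j : ℤ} (hs : P.sides = Q.sides)
    (hc : u * conj P.centre + w = Q.centre) (hb : u * conj P.base + w = Q.corner j) (k : ℤ) :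
    u * conj (P.corner k) + w = Q.corner (j - k) := by
  rw [corner_eq] at *
  rw [corner_eq, sub_eq_add_neg j, zpow_add₀ (zeta_ne_zero _), ← hs] at *
  simp only [map_add, map_mul, map_sub, map_zpow₀, conj_zeta, inv_zpow']
  linear_combination hc * (1 - zeta P.sides ^ (-k)) + hb * zeta P.sides ^ (-k)

/-- `g` maps `P` onto `Q`, respecting the cyclic order of the corners up to reversal. -/
def MapsOnto (g : ℂ → ℂ) (P Q : RegularPolygon) : Prop :=
  (∃ j : ℤ, ∀ k, g (P.corner k) = Q.corner (j + k)) ∨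
    ∃ j : ℤ, ∀ k, g (P.corner k) = Q.corner (j - k)

theorem MapsOnto.image_corners {g : ℂ → ℂ} {P Q : RegularPolygon} (h : MapsOnto g P Q) :
    g '' P.corners = Q.corners := by
  rw [corners, ← Set.range_comp]
  rcases h with ⟨j, h⟩ | ⟨j, h⟩
  · rw [show g ∘ P.corner = Q.corner ∘ Equiv.addLeft j from funext h, EquivLike.range_comp, corners]
  · rw [show g ∘ P.corner = Q.corner ∘ Equiv.subLeft j from funext h, EquivLike.range_comp, corners]

theorem MapsOnto.image_side {g : ℂ → ℂ} {P Q : RegularPolygon} (h : MapsOnto g P Q) (k : ℤ) :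
    ∃ l, g '' P.side k = Q.side l := by
  simp only [side, Set.image_pair]
  rcases h with ⟨j, h⟩ | ⟨j, h⟩
  · exact ⟨j + k, by rw [h, h, add_assoc]⟩
  · refine ⟨j - k - 1, ?_⟩
    rw [h, h, Set.pair_comm, sub_add_cancel, sub_sub]

theorem corners_eq_image (P : RegularPolygon) (h : P.sides ≠ 0) :
    P.corners = (fun k : ℕ => P.corner k) '' (Finset.range P.sides : Set ℕ) := by
  have hz := zeta_isPrimitiveRoot h
  refine Set.Subset.antisymm ?_ ?_
  · rintro _ ⟨k, rfl⟩
    have hpos : (0 : ℤ) < P.sides := by exact_mod_cast Nat.pos_of_ne_zero h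
    refine ⟨(k % P.sides).toNat, ?_, ?_⟩
    · simp only [Finset.coe_range, Set.mem_Iio]
      have := Int.emod_lt_of_pos k hpos
      have := Int.emod_nonneg k hpos.ne'
      omega
    · simp only [corner_eq, Int.toNat_of_nonneg (Int.emod_nonneg k hpos.ne')]
      congr 2
      conv_rhs => rw [← Int.emod_add_mul_ediv k P.sides, zpow_add₀ (zeta_ne_zero _), zpow_mul,
        zpow_natCast, hz.pow_eq_one, one_zpow, mul_one]
  · rintro _ ⟨k, -, rfl⟩
    exact ⟨k, rfl⟩

theorem finite_corners (P : RegularPolygon) (h : P.sides ≠ 0) : P.corners.Finite := by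
  rw [corners_eq_image P h]
  exact (Finset.finite_toSet _).image _

theorem ncard_corners_le (P : RegularPolygon) (h : P.sides ≠ 0) : P.corners.ncard ≤ P.sides := by
  rw [corners_eq_image P h]
  refine (Set.ncard_image_le (Finset.finite_toSet _)).trans ?_
  rw [Set.ncard_coe_finset, Finset.card_range]

theorem injOn_corner (P : RegularPolygon) (h : P.sides ≠ 0) (hb : P.base ≠ P.centre) :
    Set.InjOn (fun k : ℕ => P.corner k) (Finset.range P.sides : Set ℕ) := by
  intro i hi j hj hij
  simp only [corner_natCast, add_right_inj] at hij
  simp only [Finset.coe_range, Set.mem_Iio] at hi hj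
  exact (zeta_isPrimitiveRoot h).pow_inj hi hj (mul_left_cancel₀ (sub_ne_zero.2 hb) hij)

theorem ncard_corners (P : RegularPolygon) (h : P.sides ≠ 0) (hb : P.base ≠ P.centre) :
    P.corners.ncard = P.sides := by
  rw [corners_eq_image P h, (P.injOn_corner h hb).ncard_image, Set.ncard_coe_finset,
    Finset.card_range]

/-- The powers of a nontrivial root of unity sum to zero. The centre can therefore be recovered from
the bare set of corners, which is all that a face records. -/
theorem finsum_corners (P : RegularPolygon) (h : 1 < P.sides) (hb : P.base ≠ P.centre) :
    ∑ᶠ z ∈ P.corners, z = P.sides * P.centre := by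
  have h0 : P.sides ≠ 0 := by omega
  rw [corners_eq_image P h0, finsum_mem_image (P.injOn_corner h0 hb), finsum_mem_coe_finset]
  simp only [corner_natCast, Finset.sum_add_distrib, ← Finset.mul_sum,
    (zeta_isPrimitiveRoot h0).geom_sum_eq_zero h]
  simp

theorem centre_eq_of_corners_eq {P Q : RegularPolygon} (h : 1 < P.sides) (hs : P.sides = Q.sides)
    (hP : P.base ≠ P.centre) (hQ : Q.base ≠ Q.centre) (hc : P.corners = Q.corners) :
    P.centre = Q.centre := by
  have h1 := P.finsum_corners h hP
  rw [hc, Q.finsum_corners (hs ▸ h) hQ, ← hs] at h1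
  exact (mul_left_cancel₀ (by exact_mod_cast (by omega : P.sides ≠ 0)) h1).symm

/-- An isometry that maps the corners onto the corners fixes the centre. -/
theorem apply_centre {P : RegularPolygon} (h : 1 < P.sides) (hb : P.base ≠ P.centre)
    {g : ℂ ≃ᵢ ℂ} (hg : g '' P.corners = P.corners) : g P.centre = P.centre := by
  -- The image polygon has centre `g P.centre` and, by hypothesis, the same corner set as `P`; hence
  -- the same centre.
  have key (Q : RegularPolygon) (hs : P.sides = Q.sides) (h1 : g P.centre = Q.centre)
      (h2 : g P.base = Q.base) (hm : MapsOnto g P Q) : g P.centre = P.centre := by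
    rw [h1]
    refine (centre_eq_of_corners_eq h hs hb (fun e => hb (g.injective ?_)) ?_).symm
    · rw [h1, h2, e]
    · rw [← hm.image_corners, hg]
  obtain ⟨u, w, hu | hu⟩ := isometry_eq g
  · refine key ⟨P.sides, g P.centre, g P.base⟩ rfl rfl rfl (Or.inl ⟨0, fun k => ?_⟩)
    exact (hu _).trans (corner_of_rotation (P := P) (Q := ⟨P.sides, g P.centre, g P.base⟩) rfl
      (hu _).symm (by rw [corner_zero]; exact (hu _).symm) k)
  · refine key ⟨P.sides, g P.centre, g P.base⟩ rfl rfl rfl (Or.inr ⟨0, fun k => ?_⟩)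
    exact (hu _).trans (corner_of_reflection (P := P) (Q := ⟨P.sides, g P.centre, g P.base⟩) rfl
      (hu _).symm (by rw [corner_zero]; exact (hu _).symm) k)

/-- An isometry that fixes a corner, a side at this corner and the polygon is the identity. -/
theorem eq_one_of_fixes {P : RegularPolygon} (h : 2 < P.sides) (hb : P.base ≠ P.centre)
    {g : ℂ ≃ᵢ ℂ} (h0 : g (P.corner 0) = P.corner 0) (h1 : g '' P.side 0 = P.side 0)
    (hg : g '' P.corners = P.corners) : g = 1 := by
  have hc := apply_centre (by omega) hb hg
  have hz := zeta_isPrimitiveRoot (n := P.sides) (by omega)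
  have hz1 : zeta P.sides ≠ 1 := hz.ne_one (by omega)
  have hd : P.base - P.centre ≠ 0 := sub_ne_zero.2 hb
  have e1 : P.corner 1 = P.centre + (P.base - P.centre) * zeta P.sides := by
    rw [corner_eq, zpow_one]
  have h10 : P.corner 1 ≠ P.corner 0 := by
    rw [e1, corner_zero]
    intro e
    refine hz1 (mul_left_cancel₀ hd ?_)
    linear_combination e
  have h1' : g (P.corner 1) = P.corner 1 := by
    have : g (P.corner 1) ∈ P.side 0 := by
      rw [← h1]
      exact Set.mem_image_of_mem _ (by simp [side])
    simp only [side, zero_add, Set.mem_insert_iff, Set.mem_singleton_iff] at this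
    rcases this with e | e
    · exact absurd (g.injective (e.trans h0.symm)) h10
    · exact e
  rw [corner_zero] at h0
  rw [e1] at h1'
  obtain ⟨u, w, hu | hu⟩ := isometry_eq g
  · rw [hu] at h0 hc
    have hu1 : u = 1 := mul_right_cancel₀ hd (by linear_combination h0 - hc)
    have hw : w = 0 := by rw [hu1] at hc; linear_combination hc
    ext z
    rw [hu, hu1, hw]
    simp
  -- An orientation-reversing `g` fixing the centre and two adjacent corners would give `ζ⁻¹ = ζ`,
  -- so the number of sides would divide `2`.
  · exfalso
    rw [hu] at h0 hc h1'
    simp only [map_add, map_mul, map_sub, conj_zeta] at h1'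
    have e2 : u * (conj P.base - conj P.centre) = P.base - P.centre := by
      linear_combination h0 - hc
    have e3 : (zeta P.sides)⁻¹ = zeta P.sides := by
      refine mul_left_cancel₀ hd ?_
      linear_combination h1' - hc - (zeta P.sides)⁻¹ * e2
    have e4 : zeta P.sides ^ 2 = 1 := by
      rw [sq]
      nth_rewrite 1 [← e3]
      exact inv_mul_cancel₀ (zeta_ne_zero _)
    have := Nat.le_of_dvd (by norm_num) (hz.dvd_of_pow_eq_one 2 e4)
    omega

end RegularPolygon

open RegularPolygon

/-! ### The rotation and the reflection of each tessellation. -/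

/-- An isometry of finite order that permutes the polygons is a symmetry. -/
theorem mem_Sym_of_mapsOnto {t : ARegType} {o : ℂ} {g : ℂ ≃ᵢ ℂ} {m : ℕ} (hm : g ^ (m + 1) = 1)
    (h : ∀ P ∈ polygons t o, ∃ Q ∈ polygons t o, MapsOnto g P Q) :
    g ∈ Sym (tessellation t o) := by
  have hinv : g⁻¹ = g ^ m := inv_eq_of_mul_eq_one_left (by rw [← pow_succ]; exact hm)
  have hv : ∀ z ∈ (tessellation t o).vertices, g z ∈ (tessellation t o).vertices := by
    rintro z ⟨P, hP, hz⟩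
    obtain ⟨Q, hQ, hPQ⟩ := h P hP
    exact ⟨Q, hQ, hPQ.image_corners ▸ Set.mem_image_of_mem g hz⟩
  have he : ∀ e ∈ (tessellation t o).edges, g '' e ∈ (tessellation t o).edges := by
    rintro e ⟨P, hP, k, rfl⟩
    obtain ⟨Q, hQ, hPQ⟩ := h P hP
    exact ⟨Q, hQ, hPQ.image_side k⟩
  have hf : ∀ f ∈ (tessellation t o).faces, g '' f ∈ (tessellation t o).faces := by
    rintro f ⟨P, hP, rfl⟩
    obtain ⟨Q, hQ, hPQ⟩ := h P hP
    exact ⟨Q, hQ, hPQ.image_corners⟩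
  -- By finite order, `g⁻¹` is a nonnegative power of `g`, so forward invariance of a set already
  -- gives the equivalence that `Sym` demands.
  have back {α : Type} (S : Set α) (F : (ℂ ≃ᵢ ℂ) → α → α) (h1 : ∀ x, F 1 x = x)
      (hmul : ∀ a b x, F (a * b) x = F a (F b x)) (hS : ∀ x ∈ S, F g x ∈ S) (x : α) :
      F g x ∈ S ↔ x ∈ S := by
    refine ⟨fun hx => ?_, hS x⟩
    have hpow : ∀ (n : ℕ) (y : α), y ∈ S → F (g ^ n) y ∈ S := by
      intro n
      induction n with
      | zero => intro y hy; rw [pow_zero, h1]; exact hy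
      | succ n ih => intro y hy; rw [pow_succ, hmul]; exact ih _ (hS y hy)
    have := hpow m _ hx
    rwa [← hmul, ← hinv, inv_mul_cancel, h1] at this
  refine ⟨back _ (fun a z => a z) (fun _ => rfl) (fun _ _ _ => rfl) hv,
    back _ (fun a s => a '' s) ?_ ?_ he, back _ (fun a s => a '' s) ?_ ?_ hf⟩
  · exact fun s => Set.image_id s
  · exact fun a b s => Set.image_comp a b s
  · exact fun s => Set.image_id s
  · exact fun a b s => Set.image_comp a b s

/-- The vector `w` for which `z ↦ σ z̄ + w` is a reflection preserving the tessellation. -/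
def reflectionShift : ARegType → ℂ
  | .t3_3_4_3_4 => (1 - Complex.I) / 2
  | _ => 0

/-- The square of `z ↦ σ z̄ + w` is translation by `σ w̄ + w`; its vanishing makes the map an
involution, not a glide reflection. -/
theorem conj_reflectionShift (t : ARegType) :
    t.sigma * conj (reflectionShift t) + reflectionShift t = 0 := by
  cases t <;> simp [reflectionShift, ARegType.sigma, Complex.ext_iff, Complex.conj_ofNat]
  norm_num

theorem conj_sigma_mul_self (t : ARegType) : t.sigma * conj t.sigma = 1 := by
  rw [conj_sigma]; linear_combination - sigma_mul_self t

theorem norm_sigma (t : ARegType) : ‖t.sigma‖ = 1 := by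
  have h := Complex.mul_conj t.sigma
  rw [conj_sigma_mul_self, Complex.normSq_eq_norm_sq] at h
  have h2 : ‖t.sigma‖ ^ 2 = 1 := by exact_mod_cast h.symm
  nlinarith [norm_nonneg t.sigma]

/-- The isometry `z ↦ o + σ (z - o)`. -/
def rotationAt (t : ARegType) (o : ℂ) : ℂ ≃ᵢ ℂ :=
  IsometryEquiv.mk' (fun z => o + t.sigma * (z - o)) (fun z => o + conj t.sigma * (z - o))
    (fun z => by linear_combination (z - o) * conj_sigma_mul_self t)
    (Isometry.of_dist_eq fun z w => by
      rw [dist_eq_norm, dist_eq_norm, ← one_mul ‖z - w‖, ← norm_sigma t, ← norm_mul]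
      congr 1
      ring)

theorem rotationAt_apply (t : ARegType) (o z : ℂ) :
    rotationAt t o z = o + t.sigma * (z - o) := rfl

/-- The isometry `z ↦ o + (σ conj (z - o) + w)`. -/
def reflectionAt (t : ARegType) (o : ℂ) : ℂ ≃ᵢ ℂ :=
  IsometryEquiv.mk' (fun z => o + (t.sigma * conj (z - o) + reflectionShift t))
    (fun z => o + (t.sigma * conj (z - o) + reflectionShift t))
    (fun z => by
      simp only [map_sub, map_add, map_mul, Complex.conj_conj]
      linear_combination (z - o) * conj_sigma_mul_self t + conj_reflectionShift t)
    (Isometry.of_dist_eq fun z w => by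
      rw [dist_eq_norm, dist_eq_norm, ← one_mul ‖z - w‖, ← norm_sigma t, ← RCLike.norm_conj (z - w),
        ← norm_mul]
      congr 1
      simp only [map_sub]
      ring)

theorem reflectionAt_apply (t : ARegType) (o z : ℂ) :
    reflectionAt t o z = o + (t.sigma * conj (z - o) + reflectionShift t) := rfl

-- A finite check, type by type: each witness names the image tile `Q`, the translation `γ` back to
-- the prototile, and the corner `j` hit by the base corner.
set_option linter.unusedSimpArgs false in
theorem exists_rotation_tile (t : ARegType) : ∀ P ∈ prototiles t, ∃ Q ∈ prototiles t,
    ∃ (γ : t.Zσ) (j : ℕ), P.sides = Q.sides ∧ t.sigma * P.centre = Q.centre + toComplex γ ∧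
      t.sigma * P.base = Q.centre + (Q.base - Q.centre) * zeta Q.sides ^ j + toComplex γ := by
  have h3 : √3 * √3 = (3 : ℝ) := Real.mul_self_sqrt (by norm_num)
  have h2 : √2 * √2 = (2 : ℝ) := Real.mul_self_sqrt (by norm_num)
  cases t <;> simp only [prototiles, List.mem_cons, List.not_mem_nil, or_false,
    forall_eq_or_imp, forall_eq]
  · refine ⟨⟨_, .inl rfl, ⟨0, 0⟩, 2, rfl, ?_, ?_⟩,
      ⟨_, .inr rfl, ⟨-1, 0⟩, 1, rfl, ?_, ?_⟩⟩ <;>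
    simp [toComplex, zeta_eight, zeta_four, zeta_six, zeta_three, zeta_twelve, ARegType.sigma,
      Complex.ext_iff, pow_succ, omega_re, omega_im] <;> grind
  · refine ⟨⟨_, .inl rfl, ⟨0, 0⟩, 1, rfl, ?_, ?_⟩,
      ⟨_, .inr (.inr rfl), ⟨-1, 0⟩, 2, rfl, ?_, ?_⟩,
      ⟨_, .inr (.inl rfl), ⟨-1, 1⟩, 2, rfl, ?_, ?_⟩⟩ <;>
    simp [toComplex, zeta_eight, zeta_four, zeta_six, zeta_three, zeta_twelve, ARegType.sigma,
      Complex.ext_iff, pow_succ, omega_re, omega_im] <;> grind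
  · refine ⟨⟨_, .inl rfl, ⟨0, 0⟩, 2, rfl, ?_, ?_⟩,
      ⟨_, .inr (.inr rfl), ⟨-1, 0⟩, 2, rfl, ?_, ?_⟩,
      ⟨_, .inr (.inl rfl), ⟨-1, 1⟩, 2, rfl, ?_, ?_⟩⟩ <;>
    simp [toComplex, zeta_eight, zeta_four, zeta_six, zeta_three, zeta_twelve, ARegType.sigma,
      Complex.ext_iff, pow_succ, omega_re, omega_im] <;> grind
  · refine ⟨⟨_, .inl rfl, ⟨0, 0⟩, 2, rfl, ?_, ?_⟩,
      ⟨_, .inr (.inr (.inl rfl)), ⟨-1, 0⟩, 4, rfl, ?_, ?_⟩,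
      ⟨_, .inr (.inl rfl), ⟨-1, 1⟩, 4, rfl, ?_, ?_⟩,
      ⟨_, .inr (.inr (.inr (.inr (.inl rfl)))), ⟨0, 0⟩, 0, rfl, ?_, ?_⟩,
      ⟨_, .inr (.inr (.inr (.inr (.inr rfl)))), ⟨-1, 0⟩, 0, rfl, ?_, ?_⟩,
      ⟨_, .inr (.inr (.inr (.inl rfl))), ⟨-1, 1⟩, 2, rfl, ?_, ?_⟩⟩ <;>
    simp [toComplex, zeta_eight, zeta_four, zeta_six, zeta_three, zeta_twelve, ARegType.sigma,
      Complex.ext_iff, pow_succ, omega_re, omega_im] <;> grind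
  · refine ⟨⟨_, .inl rfl, ⟨0, 0⟩, 1, rfl, ?_, ?_⟩,
      ⟨_, .inr (.inr (.inl rfl)), ⟨-1, 0⟩, 2, rfl, ?_, ?_⟩,
      ⟨_, .inr (.inl rfl), ⟨-1, 1⟩, 2, rfl, ?_, ?_⟩,
      ⟨_, .inr (.inr (.inr (.inr (.inl rfl)))), ⟨0, 0⟩, 0, rfl, ?_, ?_⟩,
      ⟨_, .inr (.inr (.inr (.inr (.inr rfl)))), ⟨-1, 0⟩, 0, rfl, ?_, ?_⟩,
      ⟨_, .inr (.inr (.inr (.inl rfl))), ⟨-1, 1⟩, 2, rfl, ?_, ?_⟩⟩ <;>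
    simp [toComplex, zeta_eight, zeta_four, zeta_six, zeta_three, zeta_twelve, ARegType.sigma,
      Complex.ext_iff, pow_succ, omega_re, omega_im] <;> grind
  · refine ⟨⟨_, .inl rfl, ⟨0, 0⟩, 1, rfl, ?_, ?_⟩,
      ⟨_, .inr (.inl rfl), ⟨-1, 0⟩, 1, rfl, ?_, ?_⟩,
      ⟨_, .inr (.inr (.inr (.inr (.inl rfl)))), ⟨0, 0⟩, 0, rfl, ?_, ?_⟩,
      ⟨_, .inr (.inr (.inr (.inr (.inr rfl)))), ⟨0, 0⟩, 0, rfl, ?_, ?_⟩,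
      ⟨_, .inr (.inr (.inr (.inl rfl))), ⟨-1, 0⟩, 2, rfl, ?_, ?_⟩,
      ⟨_, .inr (.inr (.inl rfl)), ⟨-1, 0⟩, 1, rfl, ?_, ?_⟩⟩ <;>
    simp [toComplex, zeta_eight, zeta_four, zeta_six, zeta_three, zeta_twelve, ARegType.sigma,
      Complex.ext_iff, pow_succ, omega_re, omega_im] <;> grind

set_option linter.unusedSimpArgs false in
theorem exists_reflection_tile (t : ARegType) : ∀ P ∈ prototiles t, ∃ Q ∈ prototiles t,
    ∃ (γ : t.Zσ) (j : ℕ), P.sides = Q.sides ∧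
      t.sigma * conj P.centre + reflectionShift t = Q.centre + toComplex γ ∧
      t.sigma * conj P.base + reflectionShift t =
        Q.centre + (Q.base - Q.centre) * zeta Q.sides ^ j + toComplex γ := by
  have h3 : √3 * √3 = (3 : ℝ) := Real.mul_self_sqrt (by norm_num)
  have h2 : √2 * √2 = (2 : ℝ) := Real.mul_self_sqrt (by norm_num)
  cases t <;> simp only [prototiles, List.mem_cons, List.not_mem_nil, or_false,
    forall_eq_or_imp, forall_eq]
  · refine ⟨⟨_, .inl rfl, ⟨0, 0⟩, 1, rfl, ?_, ?_⟩,
      ⟨_, .inr rfl, ⟨0, 0⟩, 3, rfl, ?_, ?_⟩⟩ <;>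
    simp [toComplex, zeta_eight, zeta_four, zeta_six, zeta_three, zeta_twelve, ARegType.sigma,
      Complex.ext_iff, pow_succ, omega_re, omega_im, reflectionShift, Complex.conj_ofNat] <;> grind
  · refine ⟨⟨_, .inl rfl, ⟨0, 0⟩, 1, rfl, ?_, ?_⟩,
      ⟨_, .inr (.inl rfl), ⟨0, 0⟩, 0, rfl, ?_, ?_⟩,
      ⟨_, .inr (.inr rfl), ⟨0, 0⟩, 0, rfl, ?_, ?_⟩⟩ <;>
    simp [toComplex, zeta_eight, zeta_four, zeta_six, zeta_three, zeta_twelve, ARegType.sigma,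
      Complex.ext_iff, pow_succ, omega_re, omega_im, reflectionShift, Complex.conj_ofNat] <;> grind
  · refine ⟨⟨_, .inl rfl, ⟨0, 0⟩, 1, rfl, ?_, ?_⟩,
      ⟨_, .inr (.inl rfl), ⟨0, 0⟩, 2, rfl, ?_, ?_⟩,
      ⟨_, .inr (.inr rfl), ⟨0, 0⟩, 2, rfl, ?_, ?_⟩⟩ <;>
    simp [toComplex, zeta_eight, zeta_four, zeta_six, zeta_three, zeta_twelve, ARegType.sigma,
      Complex.ext_iff, pow_succ, omega_re, omega_im, reflectionShift, Complex.conj_ofNat] <;> grind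
  · refine ⟨⟨_, .inl rfl, ⟨0, 0⟩, 1, rfl, ?_, ?_⟩,
      ⟨_, .inr (.inl rfl), ⟨0, 0⟩, 5, rfl, ?_, ?_⟩,
      ⟨_, .inr (.inr (.inl rfl)), ⟨0, 0⟩, 5, rfl, ?_, ?_⟩,
      ⟨_, .inr (.inr (.inr (.inr (.inl rfl)))), ⟨0, 0⟩, 1, rfl, ?_, ?_⟩,
      ⟨_, .inr (.inr (.inr (.inl rfl))), ⟨0, 0⟩, 1, rfl, ?_, ?_⟩,
      ⟨_, .inr (.inr (.inr (.inr (.inr rfl)))), ⟨0, 0⟩, 3, rfl, ?_, ?_⟩⟩ <;>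
    simp [toComplex, zeta_eight, zeta_four, zeta_six, zeta_three, zeta_twelve, ARegType.sigma,
      Complex.ext_iff, pow_succ, omega_re, omega_im, reflectionShift, Complex.conj_ofNat] <;> grind
  · refine ⟨⟨_, .inl rfl, ⟨0, 0⟩, 0, rfl, ?_, ?_⟩,
      ⟨_, .inr (.inl rfl), ⟨0, 0⟩, 0, rfl, ?_, ?_⟩,
      ⟨_, .inr (.inr (.inl rfl)), ⟨0, 0⟩, 0, rfl, ?_, ?_⟩,
      ⟨_, .inr (.inr (.inr (.inr (.inl rfl)))), ⟨0, 0⟩, 1, rfl, ?_, ?_⟩,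
      ⟨_, .inr (.inr (.inr (.inl rfl))), ⟨0, 0⟩, 1, rfl, ?_, ?_⟩,
      ⟨_, .inr (.inr (.inr (.inr (.inr rfl)))), ⟨0, 0⟩, 3, rfl, ?_, ?_⟩⟩ <;>
    simp [toComplex, zeta_eight, zeta_four, zeta_six, zeta_three, zeta_twelve, ARegType.sigma,
      Complex.ext_iff, pow_succ, omega_re, omega_im, reflectionShift, Complex.conj_ofNat] <;> grind
  · refine ⟨⟨_, .inr (.inl rfl), ⟨0, -1⟩, 2, rfl, ?_, ?_⟩,
      ⟨_, .inl rfl, ⟨1, 0⟩, 2, rfl, ?_, ?_⟩,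
      ⟨_, .inr (.inr (.inl rfl)), ⟨0, 0⟩, 1, rfl, ?_, ?_⟩,
      ⟨_, .inr (.inr (.inr (.inl rfl))), ⟨0, 0⟩, 2, rfl, ?_, ?_⟩,
      ⟨_, .inr (.inr (.inr (.inr (.inr rfl)))), ⟨1, -1⟩, 0, rfl, ?_, ?_⟩,
      ⟨_, .inr (.inr (.inr (.inr (.inl rfl)))), ⟨1, -1⟩, 0, rfl, ?_, ?_⟩⟩ <;>
    simp [toComplex, zeta_eight, zeta_four, zeta_six, zeta_three, zeta_twelve, ARegType.sigma,
      Complex.ext_iff, pow_succ, omega_re, omega_im, reflectionShift, Complex.conj_ofNat] <;> grind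

theorem exists_rotation_polygon {t : ARegType} {o : ℂ} {P : RegularPolygon}
    (hP : P ∈ polygons t o) : ∃ Q ∈ polygons t o, MapsOnto (rotationAt t o) P Q := by
  obtain ⟨P, hP, γ, rfl⟩ := hP
  obtain ⟨Q, hQ, δ, j, hs, hc, hb⟩ := exists_rotation_tile t P hP
  refine ⟨_, ⟨Q, hQ, δ + sig t * γ, rfl⟩, Or.inl ⟨j, fun k => ?_⟩⟩
  have := corner_of_rotation (P := P) (Q := Q) (u := t.sigma) (w := -toComplex δ) (j := j) hs
    (by linear_combination hc) (by rw [corner_natCast]; linear_combination hb) k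
  rw [corner_translate, corner_translate, rotationAt_apply, toComplex_add, toComplex_mul,
    toComplex_sig]
  linear_combination this

theorem exists_reflection_polygon {t : ARegType} {o : ℂ} {P : RegularPolygon}
    (hP : P ∈ polygons t o) : ∃ Q ∈ polygons t o, MapsOnto (reflectionAt t o) P Q := by
  obtain ⟨P, hP, γ, rfl⟩ := hP
  obtain ⟨Q, hQ, δ, j, hs, hc, hb⟩ := exists_reflection_tile t P hP
  refine ⟨_, ⟨Q, hQ, δ + sig t * star γ, rfl⟩, Or.inr ⟨j, fun k => ?_⟩⟩
  have := corner_of_reflection (P := P) (Q := Q) (u := t.sigma)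
    (w := reflectionShift t - toComplex δ) (j := j) hs
    (by linear_combination hc) (by rw [corner_natCast]; linear_combination hb) k
  rw [corner_translate, corner_translate, reflectionAt_apply, toComplex_add, toComplex_mul,
    toComplex_sig, toComplex_star]
  simp only [map_add, map_sub]
  linear_combination this

/-- The exponent is a common multiple of the orders `4` and `6` of `i` and `ω`. -/
theorem sigma_pow_twelve (t : ARegType) : t.sigma ^ 12 = 1 := by
  have h := sigma_mul_self t
  rcases t.b_eq with hb | hb <;> rw [hb] at h <;> push_cast at h
  · have : t.sigma ^ 2 = -1 := by linear_combination h
    rw [show t.sigma ^ 12 = (t.sigma ^ 2) ^ 6 by ring, this]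
    norm_num
  · have : t.sigma ^ 3 = -1 := by linear_combination (t.sigma + 1) * h
    rw [show t.sigma ^ 12 = (t.sigma ^ 3) ^ 4 by ring, this]
    norm_num

theorem rotationAt_pow_apply (t : ARegType) (o z : ℂ) (n : ℕ) :
    (rotationAt t o ^ n) z = o + t.sigma ^ n * (z - o) := by
  induction n generalizing z with
  | zero => simp
  | succ n ih =>
    rw [pow_succ, IsometryEquiv.mul_apply, ih, rotationAt_apply]
    ring

theorem rotationAt_mem_Sym (t : ARegType) (o : ℂ) : rotationAt t o ∈ Sym (tessellation t o) := by
  refine mem_Sym_of_mapsOnto (m := 11) ?_ fun P hP => exists_rotation_polygon hP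
  ext z
  rw [rotationAt_pow_apply, sigma_pow_twelve]
  simp

theorem reflectionAt_mem_Sym (t : ARegType) (o : ℂ) :
    reflectionAt t o ∈ Sym (tessellation t o) := by
  refine mem_Sym_of_mapsOnto (m := 1) ?_ fun P hP => exists_reflection_polygon hP
  ext z
  rw [sq, IsometryEquiv.mul_apply]
  exact (reflectionAt t o).apply_symm_apply z

/-! ### The full translation group and the flags of the tessellation. -/

/-- A face with the greatest number of sides, no other face being a translate of it. -/
theorem exists_largest_tile (t : ARegType) : ∃ P₀ ∈ prototiles t, 2 < P₀.sides ∧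
    P₀.base ≠ P₀.centre ∧ ∀ P ∈ prototiles t, P.sides ≠ 0 ∧
      (P.sides < P₀.sides ∨ P = P₀ ∨ ∀ a, (P₀.translate a).corners ≠ P.corners) := by
  have h3 : √3 * √3 = (3 : ℝ) := Real.mul_self_sqrt (by norm_num)
  have h3' : 0 ≤ √3 := Real.sqrt_nonneg 3
  cases t
  -- Only this type has two translation classes of largest faces, both squares. Comparing centres
  -- determines `a`, and then a corner of the translated first square is none of the four corners of
  -- the second.
  case t3_3_4_3_4 =>
    refine ⟨_, List.mem_cons_self, by norm_num, ?_, ?_⟩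
    · intro h
      have h1 := congrArg Complex.re h
      simp at h1
      nlinarith
    · simp only [prototiles, List.mem_cons, List.not_mem_nil, or_false, forall_eq_or_imp,
        forall_eq]
      refine ⟨by simp, ⟨by simp, Or.inr (Or.inr fun a ha => ?_)⟩, by simp, by simp, by simp,
        by simp⟩
      have hc := centre_eq_of_corners_eq (by simp [RegularPolygon.translate])
        (by simp [RegularPolygon.translate]) ?_ ?_ ha
      · simp only [RegularPolygon.translate, zero_add] at hc
        have hm := Set.mem_range_self (f := (RegularPolygon.translate ⟨4, 0,
          (((3 - √3) / 4 : ℝ) : ℂ) + (((√3 - 1) / 4 : ℝ) : ℂ) * Complex.I⟩ a).corner) 0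
        change _ ∈ RegularPolygon.corners _ at hm
        rw [ha, corners_eq_image _ (by simp)] at hm
        obtain ⟨k, hk, hk'⟩ := hm
        simp only [Finset.coe_range, Set.mem_Iio] at hk
        beta_reduce at hk'
        rw [corner_natCast, corner_zero, hc] at hk'
        simp only [RegularPolygon.translate, zeta_four] at hk'
        interval_cases k <;> simp [Complex.ext_iff, pow_succ] at hk' <;> nlinarith
      · intro h
        have h1 := congrArg Complex.re h
        simp [RegularPolygon.translate] at h1
        nlinarith
      · intro h
        have h1 := congrArg Complex.re h
        simp at h1
        nlinarith
  all_goals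
    refine ⟨_, List.mem_cons_self, by norm_num, ?_, by simp [prototiles]⟩
    intro h
    have h1 := congrArg Complex.re h
    simp at h1
  all_goals nlinarith

/-- A translation preserving `τ` carries the distinguished largest face to a face of the same class:
a smaller face has too few corners, and no other prototile is a translate of it. The two centres
then differ by an element of `ℤ[σ]`. This puts the lattice of every toroidal map inside `ℤ[σ]`. -/
theorem mem_translations_iff {t : ARegType} {o a : ℂ} :
    a ∈ translations (tessellation t o) ↔ ∃ γ : t.Zσ, toComplex γ = a := by
  refine ⟨fun ha => ?_, ?_⟩
  swap
  · rintro ⟨γ, rfl⟩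
    exact toComplex_mem_translations t o γ
  obtain ⟨P₀, hP₀, hs, hb, hP⟩ := exists_largest_tile t
  have hface : (P₀.translate (o + toComplex (0 : t.Zσ))).corners ∈ (tessellation t o).faces :=
    ⟨_, ⟨P₀, hP₀, 0, rfl⟩, rfl⟩
  obtain ⟨_, ⟨P, hPt, γ, rfl⟩, hPc⟩ := (ha.2.2 _).2 hface
  have himage : (fun z => z + a) '' (P₀.translate o).corners =
      (P.translate (o + toComplex γ)).corners := by
    rw [← hPc]
    simp [toComplex]
  have key : (P₀.translate (a - toComplex γ)).corners = P.corners := by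
    have h := congrArg (fun s => (fun z => z + (-(o + toComplex γ))) '' s) himage
    simp only [corners_translate, Set.image_image, add_neg_cancel_right, Set.image_id'] at h
    rw [← h, corners_translate]
    congr 1
    funext z
    ring
  obtain ⟨h0, h | rfl | h⟩ := hP P hPt
  · have h1 := P.ncard_corners_le h0
    rw [← key, ncard_corners _ (by simp only [RegularPolygon.translate]; omega)
      (by simpa [RegularPolygon.translate] using hb)] at h1
    simp only [RegularPolygon.translate] at h1
    omega
  · have := centre_eq_of_corners_eq (P := P.translate (a - toComplex γ)) (Q := P)
      (by simp only [RegularPolygon.translate]; omega) rfl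
      (by simpa [RegularPolygon.translate] using hb) hb key
    simp only [RegularPolygon.translate] at this
    exact ⟨γ, by linear_combination -this⟩
  · exact absurd key (h _)

/-- The tessellation has finitely many flags up to translation. -/
theorem exists_finite_flags (t : ARegType) (o : ℂ) :
    ∃ S : Set (PlaneFlag (tessellation t o)), S.Finite ∧ ∀ Φ : PlaneFlag (tessellation t o),
      ∃ (a : ℂ) (ha : a ∈ translations (tessellation t o)), translationSym a ha • Φ ∈ S := by
  obtain ⟨P₀, hP₀, hs, hb, hsides⟩ := exists_largest_tile t
  set F : Set ℂ := ⋃ P ∈ {P | P ∈ prototiles t}, (P.translate o).corners with hF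
  have hFfin : F.Finite := (List.finite_toSet _).biUnion fun P hP =>
    finite_corners _ (hsides P hP).1
  refine ⟨{Φ | Φ.face ⊆ F}, ?_, fun Φ => ?_⟩
  · have hfin : (F ×ˢ ((𝒫 F) ×ˢ (𝒫 F))).Finite :=
      hFfin.prod (hFfin.finite_subsets.prod hFfin.finite_subsets)
    refine Set.Finite.of_finite_image (f := fun Φ => (Φ.vertex, Φ.edge, Φ.face))
      (hfin.subset ?_) ?_
    · rintro _ ⟨Φ, hΦ, rfl⟩
      exact ⟨hΦ (Φ.edge_subset_face Φ.vertex_mem_edge), Φ.edge_subset_face.trans hΦ, hΦ⟩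
    · intro Φ _ Ψ _ h
      simp only [Prod.mk.injEq] at h
      exact PlaneFlag.ext h.1 h.2.1 h.2.2
  · obtain ⟨_, ⟨P, hP, γ, rfl⟩, hΦ⟩ := Φ.face_mem
    refine ⟨toComplex (-γ), toComplex_mem_translations t o _, ?_⟩
    change (fun z => z + toComplex (-γ)) '' Φ.face ⊆ F
    rw [hΦ, corners_translate, Set.image_image]
    rintro _ ⟨z, hz, rfl⟩
    refine Set.mem_biUnion hP ?_
    rw [corners_translate]
    exact ⟨z, hz, by rw [toComplex_neg]; ring⟩

/-- The tessellation has a flag that is fixed by the identity only. -/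
theorem exists_flag_stabilizer_trivial (t : ARegType) (o : ℂ) :
    ∃ Φ : PlaneFlag (tessellation t o), ∀ γ : Sym (tessellation t o), γ • Φ = Φ → γ = 1 := by
  obtain ⟨P, hP, hs, hb, -⟩ := exists_largest_tile t
  set Q := P.translate (o + toComplex (0 : t.Zσ)) with hQ
  have hQp : Q ∈ polygons t o := ⟨P, hP, 0, rfl⟩
  refine ⟨⟨Q.corner 0, Q.side 0, Q.corners, ⟨Q, hQp, 0, rfl⟩, ⟨Q, hQp, 0, rfl⟩, ⟨Q, hQp, rfl⟩,
    by simp [side], ?_⟩, fun γ h => Subtype.ext ?_⟩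
  · rintro _ (rfl | rfl) <;> exact ⟨_, rfl⟩
  · exact eq_one_of_fixes (P := Q) hs (by simpa [hQ, RegularPolygon.translate] using hb)
      (congrArg PlaneFlag.vertex h) (congrArg PlaneFlag.edge h) (congrArg PlaneFlag.face h)

/-! ### Almost regular maps and conjugation-stable ideals. -/

theorem almostRegular_iff_forall {t : ARegType} {o : ℂ} (M : ToroidalMap (tessellation t o)) :
    M.AlmostRegular ↔ ∀ γ : Sym (tessellation t o), ∀ a ∈ M.lattice,
      γ.1 a - γ.1 0 ∈ M.lattice := by
  obtain ⟨S, hS, hS'⟩ := exists_finite_flags t o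
  obtain ⟨Φ, hΦ⟩ := exists_flag_stabilizer_trivial t o
  exact M.almostRegular_iff hS hS' Φ hΦ

/-- The linear part of a symmetry is `x ↦ u x` or `x ↦ u x̄` with `u ∈ ℤ[σ]`. -/
theorem exists_linear_part {t : ARegType} {o : ℂ} (γ : Sym (tessellation t o)) :
    ∃ u : t.Zσ, (∀ x : t.Zσ, γ.1 (toComplex x) - γ.1 0 = toComplex (u * x)) ∨
      ∀ x : t.Zσ, γ.1 (toComplex x) - γ.1 0 = toComplex (u * star x) := by
  -- The multiplier is the image of `1` under the linear part; that image is again a translation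
  -- vector, hence in `ℤ[σ]`.
  obtain ⟨u', hu'⟩ := mem_translations_iff.1
    (Sym.sub_mem_translations γ (toComplex_mem_translations t o 1))
  obtain ⟨u, w, h | h⟩ := isometry_eq γ.1
  · refine ⟨u', Or.inl fun x => ?_⟩
    rw [toComplex_mul, hu', toComplex_one, h, h, h]
    ring
  · refine ⟨u', Or.inr fun x => ?_⟩
    rw [toComplex_mul, hu', toComplex_one, toComplex_star, h, h, h]
    simp

theorem mem_torus_lattice {t : ARegType} {o : ℂ} {η : t.Zσ}
    {h : LinearIndependent ℝ ![toComplex η, toComplex (sig t * η)]} {a : ℂ} :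
    a ∈ (torus t o η (sig t * η) h).lattice ↔ ∃ z, toComplex (η * z) = a := by
  rw [torus_lattice, AddSubgroup.mem_map]
  constructor
  · rintro ⟨x, hx, rfl⟩
    obtain ⟨z, rfl⟩ := mem_closure_sig_mul.1 hx
    exact ⟨z, rfl⟩
  · rintro ⟨z, rfl⟩
    exact ⟨_, mem_closure_sig_mul.2 ⟨z, rfl⟩, rfl⟩

/-- An ideal absorbs the multiplier `u` of a linear part, and `η̄ ∈ (η)` handles the conjugating
ones. -/
theorem torus_almostRegular {t : ARegType} {o : ℂ} {η : t.Zσ} (hη : ∃ w, star η = η * w)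
    (h : LinearIndependent ℝ ![toComplex η, toComplex (sig t * η)]) :
    (torus t o η (sig t * η) h).AlmostRegular := by
  rw [almostRegular_iff_forall]
  intro γ a ha
  obtain ⟨z, rfl⟩ := mem_torus_lattice.1 ha
  obtain ⟨w, hw⟩ := hη
  obtain ⟨u, hu | hu⟩ := exists_linear_part γ <;> rw [hu, mem_torus_lattice]
  · exact ⟨u * z, by rw [mul_left_comm]⟩
  · refine ⟨u * w * star z, ?_⟩
    rw [star_mul', hw]
    congr 1
    ring

/-- The lattice of an almost regular map is stable under `σ` and conjugation. -/
theorem mem_lattice_of_almostRegular {t : ARegType} {o : ℂ}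
    {M : ToroidalMap (tessellation t o)} (hM : M.AlmostRegular) {x : t.Zσ}
    (hx : toComplex x ∈ M.lattice) (z : t.Zσ) :
    toComplex (z * x) ∈ M.lattice ∧ toComplex (z * star x) ∈ M.lattice := by
  rw [almostRegular_iff_forall] at hM
  have hrot (a : ℂ) (ha : a ∈ M.lattice) : t.sigma * a ∈ M.lattice := by
    have := hM ⟨_, rotationAt_mem_Sym t o⟩ a ha
    simp only [rotationAt_apply] at this
    convert this using 1
    ring
  have hrefl (a : ℂ) (ha : a ∈ M.lattice) : t.sigma * conj a ∈ M.lattice := by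
    have := hM ⟨_, reflectionAt_mem_Sym t o⟩ a ha
    simp only [reflectionAt_apply, map_sub, map_zero] at this
    convert this using 1
    ring
  have hmul (y z : t.Zσ) (hy : toComplex y ∈ M.lattice) : toComplex (z * y) ∈ M.lattice := by
    have : toComplex (z * y) = z.re • toComplex y + z.im • (t.sigma * toComplex y) := by
      rw [toComplex_mul, toComplex, zsmul_eq_mul, zsmul_eq_mul]
      ring
    rw [this]
    exact add_mem (zsmul_mem hy _) (zsmul_mem (hrot _ hy) _)
  refine ⟨hmul x z hx, ?_⟩
  -- The reflection only supplies `σ x̄`; multiplying by `σ̄ = σ⁻¹` recovers `x̄`.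
  have h1 : toComplex (sig t * star x) ∈ M.lattice := by
    rw [toComplex_mul, toComplex_sig, toComplex_star]
    exact hrefl _ hx
  have h2 := hmul _ (z * star (sig t)) h1
  have h3 : star (sig t) * sig t = 1 := by
    apply toComplex_injective
    rw [toComplex_mul, toComplex_star, toComplex_sig, toComplex_one, mul_comm,
      conj_sigma_mul_self]
  rwa [show z * star (sig t) * (sig t * star x) = z * (star (sig t) * sig t) * star x by ring,
    h3, mul_one] at h2

end

end ArchMap

open ArchMap in
/-- The map `τ_η = τ_{η, ση}` is the unique minimal almost regular cover of `τ_{α,β}`. -/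
theorem mainTheorem1 (t : ArchMap.ARegType) (o : ℂ) (α β : t.Zσ)
    (hαβ : LinearIndependent ℝ ![ArchMap.toComplex α, ArchMap.toComplex β]) :
    ∃ (η : t.Zσ)
      (hη : LinearIndependent ℝ
        ![ArchMap.toComplex η, ArchMap.toComplex (ArchMap.sig t * η)]),
      ArchMap.toComplex η = ArchMap.etaMin α β ∧
      (∀ N : ArchMap.ToroidalMap (ArchMap.tessellation t o),
        N.IsMinimalAlmostRegularCover (ArchMap.torus t o α β hαβ) ↔
          N = ArchMap.torus t o η (ArchMap.sig t * η) hη) ∧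
      ∃ K : ℕ, (K : ℚ) = ArchMap.sheetsMin α β ∧
        (ArchMap.torus t o η (ArchMap.sig t * η) hη).IsSheetedCover
          (ArchMap.torus t o α β hαβ) K := by
  have hΔ := (linearIndependent_iff α β).1 hαβ
  obtain ⟨η, hη, hnorm, hstar, hle, hge, hK⟩ := exists_etaMin hΔ
  rw [← star_mul_sig_mul_im] at hnorm hK
  have hli := (linearIndependent_iff η (sig t * η)).2 hnorm
  have hsub : AddSubgroup.closure {η, sig t * η} ≤ AddSubgroup.closure {α, β} := by
    intro x hx
    obtain ⟨z, rfl⟩ := mem_closure_sig_mul.1 hx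
    exact hle z
  have hcov : (torus t o η (sig t * η) hli).Covers (torus t o α β hαβ) := by
    rw [ToroidalMap.Covers, torus_lattice, torus_lattice]
    exact AddSubgroup.map_mono hsub
  have hmem {x : t.Zσ} : toComplex x ∈ (torus t o α β hαβ).lattice ↔
      x ∈ AddSubgroup.closure {α, β} := by
    rw [torus_lattice, AddSubgroup.mem_map]
    exact ⟨fun ⟨y, hy, h⟩ => toComplex_injective h ▸ hy, fun h => ⟨x, h, rfl⟩⟩
  refine ⟨η, hli, hη, fun N => ToroidalMap.isMinimalAlmostRegularCover_iff
    (torus_almostRegular hstar hli) hcov (fun N hN hNM a ha => ?_) N,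
    _, ?_, ToroidalMap.isSheetedCover hcov⟩
  · obtain ⟨x, rfl⟩ := mem_translations_iff.1 (N.le_translations ha)
    obtain ⟨z, rfl⟩ := hge x fun z =>
      ⟨hmem.1 (hNM (mem_lattice_of_almostRegular hN ha z).1),
        hmem.1 (hNM (mem_lattice_of_almostRegular hN ha z).2)⟩
    exact mem_torus_lattice.2 ⟨z, rfl⟩
  -- The number of sheets times the index `|Im(ᾱ β)|` of `⟨α, β⟩` in `ℤ[σ]` is the index `|N(η)|` of
  -- `(η)`.
  · have h1 := AddSubgroup.relIndex_mul_index hsub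
    rw [index_closure_pair hΔ, index_closure_pair hnorm] at h1
    rw [torus_lattice, torus_lattice, AddSubgroup.relIndex_map_map_of_injective _ _
      (f := toComplexHom t) toComplex_injective]
    have h2 : ((star α * β).im.natAbs : ℚ) ≠ 0 := by
      exact_mod_cast Int.natAbs_ne_zero.2 hΔ
    refine mul_right_cancel₀ h2 ?_
    have h3 := congrArg (Nat.cast : ℕ → ℚ) h1
    push_cast at h3 ⊢
    rw [h3, Nat.cast_natAbs, Nat.cast_natAbs]
    push_cast
    exact hK
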